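/- **Theorem 3.** Let $A\in\mathbb R^{n\times n}$, $B\in\mathbb R^{n\times m}$, and let $w(0),w(1),\dots$ be i.i.d. random vectors taking the pairwise distinct values $w_1,\dots,w_M\in\mathbb R^n$ with probabilities $p_1,\dots,p_M$, $\sum_i p_i=1$; put $\mathbf W=[w_1\ \cdots\ w_M]$, $\mathbf p_w=(p_1,\dots,p_M)'$, $\mu_w=\mathbf W\mathbf p_w$ ($'$ is the transpose). Consider $x(t+1)=Ax(t)+Bu(t)+w(t)$, $x(0)=x_0\in\mathbb R^n$, with the cost $$J_T(u)=\sum_{t=0}^{T}\mathbf E\big[x'(t)Qx(t)+u'(t)Ru(t)\big]$$ and no terminal weight. Let $J_T^*$ be the infimum of $J_T(u)$ over all square integrable controls $u$ such that $u(t)$ is measurable with respect to $w(0),\dots,w(t-1)$ (the law of the noise being known). Assume H1) $Q$ and $R$ do not depend on time, $Q=Q'\ge 0$, $R=R'>0$; H2) $(A,B)$ is stabilizable and $(A,Q^{1/2})$ is observable. For $0\le t\le T$ let $\Upsilon_T(t)=R+B'P_T(t+1)B$, $$P_T(t)=A'P_T(t+1)A+Q-A'P_T(t+1)B\,\Upsilon_T(t)^{-1}B'P_T(t+1)A,$$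 $$L_T(t)=\big(A'-A'P_T(t+1)B\,\Upsilon_T(t)^{-1}B'\big)\big(P_T(t+1)+L_T(t+1)\big),$$ with $P_T(T+1)=L_T(T+1)=0$, and $$D_T(t)=(P_T(t+1)+L_T(t+1))'B\,\Upsilon_T(t)^{-1}B'(P_T(t+1)+L_T(t+1)).$$ Let $\xi(i)$ be the $j$-th unit vector of $\mathbb R^M$ when $w(i)=w_j$, let $\hat{\mathbf p}(t)=\frac1t\sum_{i=0}^{t-1}\xi(i)$ for $t\ge1$ and $\hat{\mathbf p}(0)=0$ be the linear minimum mean square unbiased estimate (LMMSUE) of $\mathbf p_w$, and let $\hat\mu_w(t)=\mathbf W\hat{\mathbf p}(t)$. Let $\hat u$ be the online policy $$\hat u(t)=-\Upsilon_T(t)^{-1}\big(B'P_T(t+1)Ax(t)+B'P_T(t+1)\hat\mu_w(t)+B'L_T(t+1)\hat\mu_w(t)\big),$$ where $x$ is the state generated by $\hat u$ itself. Then the regret $Reg_T(\hat u)=J_T(\hat u)-J_T^*$ satisfies the following. (i) There is a constant $\hat c>0$, independent of $T$ and $x_0$, such that for all $x_0\in\mathbb R^n$ and all $T\ge0$ $$Reg_T(\hat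 u)\le \mathrm{Tr}\big(D_T(0)\mu_w\mu_w'\big)+\hat c\sum_{t=1}^{T}\frac1t .$$ (ii) For every $x_0$, $Reg_T(\hat u)=O(\ln T)$ as $T\to\infty$. -/

import Mathlib

open MeasureTheory ProbabilityTheory Filter Matrix
open scoped MatrixOrder Topology

noncomputable section

namespace OnlineLQ

/-! Pairs of matrices. -/

/-- `(A, B)` is stabilizable: for some state feedback `u = K x`, every trajectory of the closed
loop `x(t+1) = (A + B K) x(t)` tends to zero. -/
def Stabilizable {n m : ℕ} (A : Matrix (Fin n) (Fin n) ℝ) (B : Matrix (Fin n) (Fin m) ℝ) : Prop :=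
  ∃ K : Matrix (Fin m) (Fin n) ℝ, ∀ x : Fin n → ℝ,
    Tendsto (fun t : ℕ => ((A + B * K) ^ t) *ᵥ x) atTop (𝓝 0)

/-- `(A, C)` is observable: an initial state of `x(t+1) = A x(t)` whose output `y(t) = C x(t)`
vanishes at all times is zero. -/
def Observable {n q : ℕ} (A : Matrix (Fin n) (Fin n) ℝ) (C : Matrix (Fin q) (Fin n) ℝ) : Prop :=
  ∀ x : Fin n → ℝ, (∀ t : ℕ, C *ᵥ ((A ^ t) *ᵥ x) = 0) → x = 0

/-! The Riccati equation and its adjoint, for the weights `Q(t)`, `R(t)` and the terminal weight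
`S = P_{T+1}`. -/

section Riccati

variable {n m : ℕ} (A : Matrix (Fin n) (Fin n) ℝ) (B : Matrix (Fin n) (Fin m) ℝ)
  (Q : ℕ → Matrix (Fin n) (Fin n) ℝ) (R : ℕ → Matrix (Fin m) (Fin m) ℝ)
  (S : Matrix (Fin n) (Fin n) ℝ) (T : ℕ)

/-- `riccatiBack k = P_T(T + 1 - k)`: the backward Riccati recursion, `k` steps from the end. -/
def riccatiBack : ℕ → Matrix (Fin n) (Fin n) ℝ
  | 0 => S
  | k + 1 =>
    Aᵀ * riccatiBack k * A + Q (T - k)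
      - Aᵀ * riccatiBack k * B * (R (T - k) + Bᵀ * riccatiBack k * B)⁻¹ * Bᵀ * riccatiBack k * A

/-- `P_T(t)`, for `t ≤ T + 1`. -/
def riccatiP (t : ℕ) : Matrix (Fin n) (Fin n) ℝ := riccatiBack A B Q R S T (T + 1 - t)

/-- `Υ_T(t) = R(t) + B' P_T(t+1) B`, for `t ≤ T`. -/
def upsilon (t : ℕ) : Matrix (Fin m) (Fin m) ℝ := R t + Bᵀ * riccatiP A B Q R S T (t + 1) * B

/-- `adjointBack k = L_T(T + 1 - k)`: the backward adjoint recursion, `k` steps from the end. -/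
def adjointBack : ℕ → Matrix (Fin n) (Fin n) ℝ
  | 0 => 0
  | k + 1 =>
    (Aᵀ - Aᵀ * riccatiBack A B Q R S T k * B
        * (R (T - k) + Bᵀ * riccatiBack A B Q R S T k * B)⁻¹ * Bᵀ)
      * (riccatiBack A B Q R S T k + adjointBack k)

/-- `L_T(t)`, for `t ≤ T + 1`. -/
def adjointL (t : ℕ) : Matrix (Fin n) (Fin n) ℝ := adjointBack A B Q R S T (T + 1 - t)

/-- `D_T(t) = (P_T(t+1) + L_T(t+1))' B Υ_T(t)⁻¹ B' (P_T(t+1) + L_T(t+1))`, for `t ≤ T`. -/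
def matD (t : ℕ) : Matrix (Fin n) (Fin n) ℝ :=
  (riccatiP A B Q R S T (t + 1) + adjointL A B Q R S T (t + 1))ᵀ * B
    * (upsilon A B Q R S T t)⁻¹ * Bᵀ
    * (riccatiP A B Q R S T (t + 1) + adjointL A B Q R S T (t + 1))

end Riccati

/-! The noise and its estimated statistics. -/

/-- `w(0), w(1), …` are i.i.d. random vectors that take the pairwise distinct values
`w_1, …, w_M` with probabilities `p_1, …, p_M`. -/
structure IsNoise {n M : ℕ} {Ω : Type*} [MeasurableSpace Ω] (μ : Measure Ω)
    (v : Fin M → Fin n → ℝ) (p : Fin M → ℝ) (w : ℕ → Ω → Fin n → ℝ) : Prop where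
  distinct : Function.Injective v
  sum_eq_one : ∑ i, p i = 1
  measurable : ∀ t, Measurable (w t)
  indep : iIndepFun w μ
  law : ∀ t i, μ.real {ω | w t ω = v i} = p i

/-- The matrix `W = [w_1 … w_M]`, whose columns are the values of the noise. -/
def valueMatrix {n M : ℕ} (v : Fin M → Fin n → ℝ) : Matrix (Fin n) (Fin M) ℝ :=
  Matrix.of fun i j => v j i

/-- The mean `μ_w = W p_w` of the noise. -/
def noiseMean {n M : ℕ} (v : Fin M → Fin n → ℝ) (p : Fin M → ℝ) : Fin n → ℝ :=
  valueMatrix v *ᵥ p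

/-- The observation `ξ(t)`: the `j`-th unit vector when `w(t) = w_j`. -/
def obs {n M : ℕ} {Ω : Type*} (v : Fin M → Fin n → ℝ) (w : ℕ → Ω → Fin n → ℝ)
    (t : ℕ) (ω : Ω) : Fin M → ℝ :=
  fun j => open Classical in if w t ω = v j then 1 else 0

/-- The linear minimum mean square unbiased estimate of `p_w` at time `t`: the sample mean
`(1/t) ∑_{i<t} ξ(i)` for `t ≥ 1`, and `0` for `t = 0`. -/
def lmmsue {n M : ℕ} {Ω : Type*} (v : Fin M → Fin n → ℝ) (w : ℕ → Ω → Fin n → ℝ)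
    (t : ℕ) (ω : Ω) : Fin M → ℝ :=
  if t = 0 then 0 else (1 / (t : ℝ)) • ∑ i ∈ Finset.range t, obs v w i ω

/-- The estimate of the mean of the noise, `W` times the estimate of `p_w`. -/
def meanEstimate {n M : ℕ} {Ω : Type*} (v : Fin M → Fin n → ℝ) (w : ℕ → Ω → Fin n → ℝ)
    (t : ℕ) (ω : Ω) : Fin n → ℝ :=
  valueMatrix v *ᵥ lmmsue v w t ω

/-! The controlled system, its cost, and the regret. -/

section System

variable {n m : ℕ} {Ω : Type*} (A : Matrix (Fin n) (Fin n) ℝ) (B : Matrix (Fin n) (Fin m) ℝ)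
  (Q : ℕ → Matrix (Fin n) (Fin n) ℝ) (R : ℕ → Matrix (Fin m) (Fin m) ℝ)
  (S : Matrix (Fin n) (Fin n) ℝ) (T : ℕ) (x₀ : Fin n → ℝ) (w : ℕ → Ω → Fin n → ℝ)

/-- The state driven by the control `u`: `x(0) = x₀`, `x(t+1) = A x(t) + B u(t) + w(t)`. -/
def state (u : ℕ → Ω → Fin m → ℝ) : ℕ → Ω → Fin n → ℝ
  | 0 => fun _ => x₀
  | t + 1 => fun ω => A *ᵥ state u t ω + B *ᵥ u t ω + w t ω

/-- The cost `J_T(u) = ∑_{t=0}^T E[x(t)' Q(t) x(t) + u(t)' R(t) u(t)] + E[x(T+1)' S x(T+1)]`. -/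
def cost [MeasurableSpace Ω] (μ : Measure Ω) (u : ℕ → Ω → Fin m → ℝ) : ℝ :=
  (∑ t ∈ Finset.range (T + 1),
    ∫ ω, (state A B x₀ w u t ω ⬝ᵥ (Q t *ᵥ state A B x₀ w u t ω)
      + u t ω ⬝ᵥ (R t *ᵥ u t ω)) ∂μ)
  + ∫ ω, state A B x₀ w u (T + 1) ω ⬝ᵥ (S *ᵥ state A B x₀ w u (T + 1) ω) ∂μ

/-- The σ-algebra generated by `w(0), …, w(t-1)`: the information that the states
`x(0), …, x(t)` carry when the decision maker knows the controls applied so far. -/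
abbrev history (t : ℕ) : MeasurableSpace Ω :=
  ⨆ (s : ℕ) (_ : s < t), MeasurableSpace.comap (w s) inferInstance

/-- Nonanticipative square integrable controls. They may depend in any way on the law of the
noise. -/
def Admissible [MeasurableSpace Ω] (μ : Measure Ω) (u : ℕ → Ω → Fin m → ℝ) : Prop :=
  ∀ t, Measurable[history w t] (u t) ∧ MemLp (u t) 2 μ

/-- The known-statistics optimum `J_T^*`: the least cost of an admissible control. -/
def optimalCost [MeasurableSpace Ω] (μ : Measure Ω) : ℝ :=
  sInf {J : ℝ | ∃ u : ℕ → Ω → Fin m → ℝ, Admissible w μ u ∧ J = cost A B Q R S T x₀ w μ u}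

/-- The online feedback law: the control applied at time `t` in the state `x` when the current
estimate of the mean of the noise is `e`,
`-Υ_T(t)⁻¹ (B' P_T(t+1) A x + B' P_T(t+1) e + B' L_T(t+1) e)`. -/
def feedback (t : ℕ) (x e : Fin n → ℝ) : Fin m → ℝ :=
  -((upsilon A B Q R S T t)⁻¹ *ᵥ
    ((Bᵀ * riccatiP A B Q R S T (t + 1) * A) *ᵥ x
      + (Bᵀ * riccatiP A B Q R S T (t + 1)) *ᵥ e
      + (Bᵀ * adjointL A B Q R S T (t + 1)) *ᵥ e))

/-- The state under the online policy. -/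
def onlineState {M : ℕ} (v : Fin M → Fin n → ℝ) : ℕ → Ω → Fin n → ℝ
  | 0 => fun _ => x₀
  | t + 1 => fun ω =>
    A *ᵥ onlineState v t ω
      + B *ᵥ feedback A B Q R S T t (onlineState v t ω) (meanEstimate v w t ω) + w t ω

/-- The online policy `û`: the feedback law applied to the current state and the current estimate
of the mean of the noise. It does not involve the probabilities of the noise. -/
def onlinePolicy {M : ℕ} (v : Fin M → Fin n → ℝ) (t : ℕ) (ω : Ω) : Fin m → ℝ :=
  feedback A B Q R S T t (onlineState A B Q R S T x₀ w v t ω) (meanEstimate v w t ω)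

/-- The regret `J_T(û) - J_T^*` of the online policy. -/
def regret {M : ℕ} [MeasurableSpace Ω] (μ : Measure Ω) (v : Fin M → Fin n → ℝ) : ℝ :=
  cost A B Q R S T x₀ w μ (onlinePolicy A B Q R S T x₀ w v) - optimalCost A B Q R S T x₀ w μ

end System

end OnlineLQ

end

namespace OnlineLQ

/-! Quadratic forms and the Euclidean operator norm of real matrices. -/

section LinearAlgebra

open scoped Matrix.Norms.L2Operator

variable {n m l : ℕ}

/-! When the mean $\mu_w$ is known, the Bellman function is $x'Px+2x'L\mu_w$ plus a constant.
Completing the square in the control and summing over time turns the cost of any admissible control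
into a constant `knownMeanCost` plus $\sum_t E|u(t)-f_t(x(t))|^2_{\Upsilon_T(t)}$, where $f_t$ is
the feedback that uses the true mean (`cost_eq_knownMeanCost_add`). The cross terms vanish because
$w(t)-\mu_w$ is centred and independent of the past. The constant is thus a lower bound for $J_T^*$.

At one and the same state, the online feedback differs from $f_t$ only through the estimation error,
and the square equals $(\hat\mu_w-\mu_w)'D_T(t)(\hat\mu_w-\mu_w)$ (`feedback_sub_quadratic`). The
initial state drops out. At $t=0$ the estimate is $0$, which gives the trace term; at $t\ge1$ the
mean square error is $O(1/t)$.

What remains is a bound on $D_T(t)$ uniform in $t\le T$ (`exists_matD_le`). Stabilizability bounds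
$P$, and $R>0$ bounds $\Upsilon^{-1}$. For $L$ the products of time-varying closed loops must decay
uniformly. This comes from explicit Lyapunov forms (`exists_contracting_forms`), with no appeal to
convergence of the Riccati iterates. Part (ii) then follows from the logarithmic growth of the
harmonic sum and from nonnegativity of the regret. -/

theorem dotProduct_transpose_mulVec (M : Matrix (Fin n) (Fin m) ℝ) (x : Fin m → ℝ)
    (y : Fin n → ℝ) : x ⬝ᵥ (Mᵀ *ᵥ y) = (M *ᵥ x) ⬝ᵥ y := by
  rw [dotProduct_mulVec, vecMul_transpose]

theorem dotProduct_mulVec_symm {M : Matrix (Fin n) (Fin n) ℝ} (hM : Mᵀ = M) (x y : Fin n → ℝ) :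
    x ⬝ᵥ (M *ᵥ y) = y ⬝ᵥ (M *ᵥ x) := by
  conv_lhs => rw [← hM]
  rw [dotProduct_transpose_mulVec, dotProduct_comm]

theorem dotProduct_self_nonneg' (x : Fin n → ℝ) : 0 ≤ x ⬝ᵥ x :=
  Finset.sum_nonneg fun i _ => mul_self_nonneg (x i)

theorem norm_toLp_sq (x : Fin n → ℝ) : ‖WithLp.toLp 2 x‖ ^ 2 = x ⬝ᵥ x := by
  rw [EuclideanSpace.norm_sq_eq]
  simp [dotProduct, sq]

theorem norm_toLp_mulVec_le (M : Matrix (Fin n) (Fin m) ℝ) (x : Fin m → ℝ) :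
    ‖WithLp.toLp 2 (M *ᵥ x)‖ ≤ ‖M‖ * ‖WithLp.toLp 2 x‖ :=
  l2_opNorm_mulVec M (WithLp.toLp 2 x)

theorem dotProduct_le_norm (x y : Fin n → ℝ) :
    x ⬝ᵥ y ≤ ‖WithLp.toLp 2 x‖ * ‖WithLp.toLp 2 y‖ := by
  have := real_inner_le_norm (WithLp.toLp 2 y) (WithLp.toLp 2 x)
  rw [EuclideanSpace.inner_eq_star_dotProduct] at this
  simpa [mul_comm] using this

theorem dotProduct_mulVec_le (M : Matrix (Fin n) (Fin n) ℝ) (x : Fin n → ℝ) :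
    x ⬝ᵥ (M *ᵥ x) ≤ ‖M‖ * (x ⬝ᵥ x) := by
  have h1 := dotProduct_le_norm x (M *ᵥ x)
  have h2 := norm_toLp_mulVec_le M x
  rw [← norm_toLp_sq]
  nlinarith [norm_nonneg (WithLp.toLp 2 x)]

theorem norm_le_of_norm_mulVec_le {M : Matrix (Fin n) (Fin m) ℝ} {C : ℝ} (hC : 0 ≤ C)
    (h : ∀ x, ‖WithLp.toLp 2 (M *ᵥ x)‖ ≤ C * ‖WithLp.toLp 2 x‖) : ‖M‖ ≤ C := by
  rw [l2_opNorm_def]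
  exact ContinuousLinearMap.opNorm_le_bound _ hC fun x => h x.ofLp

theorem norm_transpose_eq (M : Matrix (Fin n) (Fin m) ℝ) : ‖Mᵀ‖ = ‖M‖ := by
  rw [← conjTranspose_eq_transpose_of_trivial, l2_opNorm_conjTranspose]

theorem posSemidef_iff_real {M : Matrix (Fin n) (Fin n) ℝ} :
    M.PosSemidef ↔ Mᵀ = M ∧ ∀ x, 0 ≤ x ⬝ᵥ (M *ᵥ x) := by
  constructor
  · intro h
    refine ⟨by simpa [conjTranspose_eq_transpose_of_trivial] using h.isHermitian.eq, fun x => ?_⟩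
    simpa using h.dotProduct_mulVec_nonneg x
  · rintro ⟨h1, h2⟩
    refine .of_dotProduct_mulVec_nonneg ?_ fun x => by simpa using h2 x
    rw [IsHermitian, conjTranspose_eq_transpose_of_trivial, h1]

theorem dotProduct_sq_le_of_posSemidef {M : Matrix (Fin n) (Fin n) ℝ} (hM : M.PosSemidef)
    (x y : Fin n → ℝ) :
    (x ⬝ᵥ (M *ᵥ y)) ^ 2 ≤ (x ⬝ᵥ (M *ᵥ x)) * (y ⬝ᵥ (M *ᵥ y)) := by
  obtain ⟨hs, h0⟩ := posSemidef_iff_real.1 hM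
  have key : ∀ t : ℝ, 0 ≤ (x ⬝ᵥ (M *ᵥ x)) * (t * t) + (2 * (x ⬝ᵥ (M *ᵥ y))) * t
      + y ⬝ᵥ (M *ᵥ y) := by
    intro t
    have := h0 (t • x + y)
    simp only [mulVec_add, mulVec_smul, dotProduct_add, add_dotProduct, smul_dotProduct,
      dotProduct_smul, smul_eq_mul, dotProduct_mulVec_symm hs y x] at this
    linarith
  have := discrim_le_zero key
  rw [discrim] at this
  linarith

/-- Cauchy–Schwarz for the form $M$, applied to $y=Mx$ and $x$, gives $|y|^4\le(y'My)(x'Mx)\le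
C^2|y|^2|x|^2$. -/
theorem norm_le_of_posSemidef {M : Matrix (Fin n) (Fin n) ℝ} (hM : M.PosSemidef) {C : ℝ}
    (hC : 0 ≤ C) (h : ∀ x, x ⬝ᵥ (M *ᵥ x) ≤ C * (x ⬝ᵥ x)) : ‖M‖ ≤ C := by
  obtain ⟨-, h0⟩ := posSemidef_iff_real.1 hM
  refine norm_le_of_norm_mulVec_le hC fun x => ?_
  set y := M *ᵥ x with hy
  have h1 := dotProduct_sq_le_of_posSemidef hM y x
  have h2 := h y
  have h3 := h x
  rw [← hy, ← norm_toLp_sq] at h1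
  rw [← norm_toLp_sq] at h2 h3
  have h4 := h0 y
  have h5 := h0 x
  set a := ‖WithLp.toLp 2 y‖
  set b := ‖WithLp.toLp 2 x‖
  have ha : 0 ≤ a := norm_nonneg _
  have hb : 0 ≤ b := norm_nonneg _
  have h6 : (a ^ 2) ^ 2 ≤ (C * a ^ 2) * (C * b ^ 2) :=
    h1.trans (mul_le_mul h2 h3 h5 (by positivity))
  rcases ha.eq_or_lt with h0 | h0
  · rw [← h0]; positivity
  · refine le_of_sq_le_sq ?_ (by positivity)
    have : 0 < a ^ 2 := by positivity
    nlinarith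

/-- A positive definite form dominates a positive multiple of the square of the norm. -/
theorem exists_le_of_posDef {M : Matrix (Fin n) (Fin n) ℝ} (hM : M.PosDef) :
    ∃ c : ℝ, 0 < c ∧ ∀ x, c * (x ⬝ᵥ x) ≤ x ⬝ᵥ (M *ᵥ x) := by
  have hs := posSemidef_iff_real.1 hM.posSemidef
  have hu : IsUnit M.det := (isUnit_iff_isUnit_det M).1 hM.isUnit
  -- Cauchy–Schwarz with $M^{-1}x$ gives $|x|^4\le(x'Mx)(x'M^{-1}x)$. The added $1$ keeps the
  -- denominator positive in dimension zero.
  refine ⟨1 / (‖M⁻¹‖ + 1), by positivity, fun x => ?_⟩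
  rw [div_mul_eq_mul_div, one_mul, div_le_iff₀ (by positivity)]
  have h1 := dotProduct_sq_le_of_posSemidef hM.posSemidef x (M⁻¹ *ᵥ x)
  rw [mulVec_mulVec, mul_nonsing_inv M hu, one_mulVec] at h1
  have h2 : (M⁻¹ *ᵥ x) ⬝ᵥ x ≤ ‖M⁻¹‖ * (x ⬝ᵥ x) := by
    rw [dotProduct_comm]; exact dotProduct_mulVec_le _ _
  have h3 := hs.2 x
  rcases (dotProduct_self_nonneg' x).eq_or_lt with h0 | h0
  · rw [← h0]; positivity
  · have : (x ⬝ᵥ x) ^ 2 ≤ (x ⬝ᵥ (M *ᵥ x)) * (‖M⁻¹‖ * (x ⬝ᵥ x)) :=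
      h1.trans (mul_le_mul_of_nonneg_left h2 h3)
    nlinarith

theorem posDef_of_pos {M : Matrix (Fin n) (Fin n) ℝ} (hM : M.PosSemidef)
    (h : ∀ x, x ⬝ᵥ (M *ᵥ x) = 0 → x = 0) : M.PosDef := by
  refine .of_dotProduct_mulVec_pos hM.isHermitian fun x hx => ?_
  have := (posSemidef_iff_real.1 hM).2 x
  simpa using lt_of_le_of_ne this fun h0 => hx (h x h0.symm)

end LinearAlgebra

/-! One step of the Riccati recursion. -/

section Step

variable {n m : ℕ} {A : Matrix (Fin n) (Fin n) ℝ} {B : Matrix (Fin n) (Fin m) ℝ}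
  {Q : Matrix (Fin n) (Fin n) ℝ} {R : Matrix (Fin m) (Fin m) ℝ}
  {P : Matrix (Fin n) (Fin n) ℝ}

theorem posDef_add_conj (hR : R.PosDef) (hP : P.PosSemidef) : (R + Bᵀ * P * B).PosDef :=
  hR.add_posSemidef (by
    simpa [conjTranspose_eq_transpose_of_trivial] using hP.conjTranspose_mul_mul_same B)

/-- Completing the square in the Bellman equation with a linear term. -/
theorem complete_square (hR : R.PosDef) (hP : P.PosSemidef) (x g : Fin n → ℝ) (u : Fin m → ℝ) :
    x ⬝ᵥ (Q *ᵥ x) + u ⬝ᵥ (R *ᵥ u)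
        + (A *ᵥ x + B *ᵥ u) ⬝ᵥ (P *ᵥ (A *ᵥ x + B *ᵥ u)) + 2 * ((A *ᵥ x + B *ᵥ u) ⬝ᵥ g)
      = x ⬝ᵥ ((Aᵀ * P * A + Q - Aᵀ * P * B * (R + Bᵀ * P * B)⁻¹ * Bᵀ * P * A) *ᵥ x)
        + 2 * (x ⬝ᵥ ((Aᵀ - Aᵀ * P * B * (R + Bᵀ * P * B)⁻¹ * Bᵀ) *ᵥ g))
        + (u + (R + Bᵀ * P * B)⁻¹ *ᵥ (Bᵀ *ᵥ (P *ᵥ (A *ᵥ x)) + Bᵀ *ᵥ g)) ⬝ᵥ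
          ((R + Bᵀ * P * B) *ᵥ
            (u + (R + Bᵀ * P * B)⁻¹ *ᵥ (Bᵀ *ᵥ (P *ᵥ (A *ᵥ x)) + Bᵀ *ᵥ g)))
        - g ⬝ᵥ ((B * (R + Bᵀ * P * B)⁻¹ * Bᵀ) *ᵥ g) := by
  have hΥ : (R + Bᵀ * P * B).PosDef := posDef_add_conj hR hP
  have hPs := (posSemidef_iff_real.1 hP).1
  have hΥs := (posSemidef_iff_real.1 hΥ.posSemidef).1
  have hu : IsUnit (R + Bᵀ * P * B).det := (isUnit_iff_isUnit_det _).1 hΥ.isUnit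
  have e1 : ∀ y, (u ⬝ᵥ ((R + Bᵀ * P * B) *ᵥ y))
      = u ⬝ᵥ (R *ᵥ y) + (B *ᵥ u) ⬝ᵥ (P *ᵥ (B *ᵥ y)) := by
    intro y
    rw [add_mulVec, dotProduct_add, ← mulVec_mulVec, ← mulVec_mulVec, dotProduct_transpose_mulVec]
  set Υ := R + Bᵀ * P * B with hΥdef
  have hKs : (Υ⁻¹)ᵀ = Υ⁻¹ := by rw [transpose_nonsing_inv, hΥs]
  have e2 : ∀ y, Υ *ᵥ (Υ⁻¹ *ᵥ y) = y := by
    intro y; rw [mulVec_mulVec, mul_nonsing_inv _ hu, one_mulVec]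
  set K := Υ⁻¹
  -- Every term reduces to scalars in $u$, $Ax$, $g$, $s=B'PAx$ and $f=B'g$; the minimising control
  -- is $-K(s+f)$.
  set s := Bᵀ *ᵥ (P *ᵥ (A *ᵥ x)) with hs
  set f := Bᵀ *ᵥ g with hf
  have e3 : (K *ᵥ (s + f)) ⬝ᵥ (Υ *ᵥ u) = u ⬝ᵥ (s + f) := by
    rw [dotProduct_mulVec_symm hΥs, e2]
  have e4 : x ⬝ᵥ ((Aᵀ * P * A + Q - Aᵀ * P * B * K * Bᵀ * P * A) *ᵥ x)
      = (A *ᵥ x) ⬝ᵥ (P *ᵥ (A *ᵥ x)) + x ⬝ᵥ (Q *ᵥ x) - s ⬝ᵥ (K *ᵥ s) := by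
    have h1 : (Bᵀ * P * A) *ᵥ x = s := by simp only [← mulVec_mulVec, hs]
    have h2 : x ⬝ᵥ ((Aᵀ * P * B * K * Bᵀ * P * A) *ᵥ x) = s ⬝ᵥ (K *ᵥ s) := by
      have : (Aᵀ * P * B * K * Bᵀ * P * A) *ᵥ x = (Bᵀ * P * A)ᵀ *ᵥ (K *ᵥ ((Bᵀ * P * A) *ᵥ x)) := by
        simp only [mulVec_mulVec, transpose_mul, transpose_transpose, hPs, Matrix.mul_assoc]
      rw [this, dotProduct_transpose_mulVec, h1]
    rw [sub_mulVec, add_mulVec, dotProduct_sub, dotProduct_add, h2, ← mulVec_mulVec,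
      ← mulVec_mulVec, dotProduct_transpose_mulVec]
  have e5 : x ⬝ᵥ ((Aᵀ - Aᵀ * P * B * K * Bᵀ) *ᵥ g) = (A *ᵥ x) ⬝ᵥ g - s ⬝ᵥ (K *ᵥ f) := by
    have h1 : (Bᵀ * P * A) *ᵥ x = s := by simp only [← mulVec_mulVec, hs]
    have : (Aᵀ * P * B * K * Bᵀ) *ᵥ g = (Bᵀ * P * A)ᵀ *ᵥ (K *ᵥ f) := by
      simp only [hf, mulVec_mulVec, transpose_mul, transpose_transpose, hPs, Matrix.mul_assoc]
    rw [sub_mulVec, dotProduct_sub, this, dotProduct_transpose_mulVec, dotProduct_transpose_mulVec,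
      h1]
  have e6 : g ⬝ᵥ ((B * K * Bᵀ) *ᵥ g) = f ⬝ᵥ (K *ᵥ f) := by
    rw [← mulVec_mulVec, ← mulVec_mulVec, ← hf]
    conv_lhs => rw [← transpose_transpose B]
    rw [dotProduct_transpose_mulVec]
  have e7 : u ⬝ᵥ s = (B *ᵥ u) ⬝ᵥ (P *ᵥ (A *ᵥ x)) := by rw [hs, dotProduct_transpose_mulVec]
  have e8 : u ⬝ᵥ f = (B *ᵥ u) ⬝ᵥ g := by rw [hf, dotProduct_transpose_mulVec]
  have e9 : (K *ᵥ (s + f)) ⬝ᵥ (s + f)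
      = s ⬝ᵥ (K *ᵥ s) + 2 * (s ⬝ᵥ (K *ᵥ f)) + f ⬝ᵥ (K *ᵥ f) := by
    rw [dotProduct_comm, mulVec_add]
    simp only [dotProduct_add, add_dotProduct]
    rw [dotProduct_mulVec_symm hKs f s]
    ring
  have e10 : (u + K *ᵥ (s + f)) ⬝ᵥ (Υ *ᵥ (u + K *ᵥ (s + f)))
      = u ⬝ᵥ (R *ᵥ u) + (B *ᵥ u) ⬝ᵥ (P *ᵥ (B *ᵥ u)) + 2 * (u ⬝ᵥ (s + f))
        + (K *ᵥ (s + f)) ⬝ᵥ (s + f) := by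
    rw [mulVec_add Υ, e2, dotProduct_add, add_dotProduct, add_dotProduct, e1 u, e3]
    ring
  rw [e4, e5, e6, e10, e9, dotProduct_add, e7, e8]
  simp only [mulVec_add, dotProduct_add, add_dotProduct]
  rw [dotProduct_mulVec_symm hPs (A *ᵥ x) (B *ᵥ u)]
  ring

end Step

/-! ### The Riccati step as a minimum over one control. -/

section StepConsequences

variable {n m : ℕ} (A : Matrix (Fin n) (Fin n) ℝ) (B : Matrix (Fin n) (Fin m) ℝ)
  (Q : Matrix (Fin n) (Fin n) ℝ) (R : Matrix (Fin m) (Fin m) ℝ)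
  (P : Matrix (Fin n) (Fin n) ℝ)

/-- The image of `P` under one step of the Riccati recursion. -/
noncomputable def riccatiStep : Matrix (Fin n) (Fin n) ℝ :=
  Aᵀ * P * A + Q - Aᵀ * P * B * (R + Bᵀ * P * B)⁻¹ * Bᵀ * P * A

/-- The closed loop matrix of the feedback that is optimal for the terminal weight `P`. -/
noncomputable def closedLoop : Matrix (Fin n) (Fin n) ℝ :=
  A - B * (R + Bᵀ * P * B)⁻¹ * Bᵀ * P * A

variable {A B Q R P}

/-- Completion of the square without linear term, with the nonnegative square dropped. Testing it
with particular controls $u$ gives all the comparison estimates below. -/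
theorem riccatiStep_le (hR : R.PosDef) (hP : P.PosSemidef) (x : Fin n → ℝ) (u : Fin m → ℝ) :
    x ⬝ᵥ (riccatiStep A B Q R P *ᵥ x) ≤ x ⬝ᵥ (Q *ᵥ x) + u ⬝ᵥ (R *ᵥ u)
      + (A *ᵥ x + B *ᵥ u) ⬝ᵥ (P *ᵥ (A *ᵥ x + B *ᵥ u)) := by
  have h := complete_square (A := A) (B := B) (Q := Q) hR hP x 0 u
  have h2 := (posSemidef_iff_real.1 (posDef_add_conj (B := B) hR hP).posSemidef).2
  simp only [mulVec_zero, dotProduct_zero, mul_zero, add_zero, sub_zero] at h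
  rw [h, riccatiStep]
  linarith [h2 (u + (R + Bᵀ * P * B)⁻¹ *ᵥ Bᵀ *ᵥ P *ᵥ A *ᵥ x)]

/-- The control that annihilates the completed square attains the minimum and moves $x$ along the
closed loop. -/
theorem exists_riccatiStep_eq (hR : R.PosDef) (hP : P.PosSemidef) (x : Fin n → ℝ) :
    ∃ u : Fin m → ℝ, A *ᵥ x + B *ᵥ u = closedLoop A B R P *ᵥ x ∧
      x ⬝ᵥ (riccatiStep A B Q R P *ᵥ x) = x ⬝ᵥ (Q *ᵥ x) + u ⬝ᵥ (R *ᵥ u)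
        + (closedLoop A B R P *ᵥ x) ⬝ᵥ (P *ᵥ (closedLoop A B R P *ᵥ x)) := by
  set u := -((R + Bᵀ * P * B)⁻¹ *ᵥ Bᵀ *ᵥ P *ᵥ A *ᵥ x) with hu
  have h0 : A *ᵥ x + B *ᵥ u = closedLoop A B R P *ᵥ x := by
    rw [closedLoop, hu, sub_mulVec, mulVec_neg, ← sub_eq_add_neg]
    simp only [mulVec_mulVec, Matrix.mul_assoc]
  refine ⟨u, h0, ?_⟩
  have h := complete_square (A := A) (B := B) (Q := Q) hR hP x 0 u
  simp only [mulVec_zero, dotProduct_zero, mul_zero, add_zero, sub_zero] at h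
  rw [← h0, h, riccatiStep, hu, neg_add_cancel]
  simp

theorem posSemidef_riccatiStep (hQ : Q.PosSemidef) (hR : R.PosDef) (hP : P.PosSemidef) :
    (riccatiStep A B Q R P).PosSemidef := by
  have hPs := (posSemidef_iff_real.1 hP).1
  have hQs := (posSemidef_iff_real.1 hQ).1
  refine posSemidef_iff_real.2 ⟨?_, fun x => ?_⟩
  · rw [riccatiStep]
    simp only [transpose_sub, transpose_add, transpose_mul, transpose_transpose, hPs, hQs,
      transpose_nonsing_inv, Matrix.mul_assoc]
    have : (Rᵀ + Bᵀ * (P * B)) = R + Bᵀ * (P * B) := by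
      rw [(posSemidef_iff_real.1 hR.posSemidef).1]
    rw [this]
  · obtain ⟨u, -, h⟩ := exists_riccatiStep_eq (A := A) (B := B) (Q := Q) hR hP x
    rw [h]
    have h1 := (posSemidef_iff_real.1 hQ).2 x
    have h2 := (posSemidef_iff_real.1 hR.posSemidef).2 u
    have h3 := (posSemidef_iff_real.1 hP).2 (closedLoop A B R P *ᵥ x)
    positivity

end StepConsequences

/-! The time invariant recursions with zero terminal weight. -/

section Invariant

variable {n m : ℕ} (A : Matrix (Fin n) (Fin n) ℝ) (B : Matrix (Fin n) (Fin m) ℝ)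
  (Q : Matrix (Fin n) (Fin n) ℝ) (R : Matrix (Fin m) (Fin m) ℝ)

/-- The Riccati iterates from the terminal weight `0`. -/
noncomputable def ric : ℕ → Matrix (Fin n) (Fin n) ℝ
  | 0 => 0
  | k + 1 => riccatiStep A B Q R (ric k)

/-- The adjoint iterates from the terminal weight `0`. -/
noncomputable def adj : ℕ → Matrix (Fin n) (Fin n) ℝ
  | 0 => 0
  | k + 1 => (Aᵀ - Aᵀ * ric A B Q R k * B * (R + Bᵀ * ric A B Q R k * B)⁻¹ * Bᵀ)
      * (ric A B Q R k + adj k)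

/-- With constant weights only the number of remaining steps matters, so a bound uniform in $k$ is
uniform in $t\le T$. -/
theorem riccatiBack_eq (T k : ℕ) :
    riccatiBack A B (fun _ => Q) (fun _ => R) 0 T k = ric A B Q R k := by
  induction k with
  | zero => rfl
  | succ k ih => rw [riccatiBack, ih, ric, riccatiStep]

theorem adjointBack_eq (T k : ℕ) :
    adjointBack A B (fun _ => Q) (fun _ => R) 0 T k = adj A B Q R k := by
  induction k with
  | zero => rfl
  | succ k ih => rw [adjointBack, ih, riccatiBack_eq, adj]

variable {A B Q R}

theorem posSemidef_ric (hQ : Q.PosSemidef) (hR : R.PosDef) (k : ℕ) :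
    (ric A B Q R k).PosSemidef := by
  induction k with
  | zero => exact .zero
  | succ k ih => exact posSemidef_riccatiStep hQ hR ih

theorem dotProduct_ric_nonneg (hQ : Q.PosSemidef) (hR : R.PosDef) (k : ℕ) (x : Fin n → ℝ) :
    0 ≤ x ⬝ᵥ (ric A B Q R k *ᵥ x) :=
  (posSemidef_iff_real.1 (posSemidef_ric hQ hR k)).2 x

/-- By symmetry of $P$ and $R$, the factor in the adjoint recursion is the transposed closed loop.
Hence $L'$ accumulates $P$ along closed-loop trajectories. -/
theorem adj_succ_eq (hQ : Q.PosSemidef) (hR : R.PosDef) (k : ℕ) :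
    adj A B Q R (k + 1)
      = (closedLoop A B R (ric A B Q R k))ᵀ * (ric A B Q R k + adj A B Q R k) := by
  have hP := posSemidef_ric (A := A) (B := B) hQ hR k
  have hPs := (posSemidef_iff_real.1 hP).1
  have hRs := (posSemidef_iff_real.1 hR.posSemidef).1
  have : (closedLoop A B R (ric A B Q R k))ᵀ
      = Aᵀ - Aᵀ * ric A B Q R k * B * (R + Bᵀ * ric A B Q R k * B)⁻¹ * Bᵀ := by
    rw [closedLoop]
    simp only [transpose_sub, transpose_add, transpose_mul, transpose_transpose, hPs, hRs,
      transpose_nonsing_inv, Matrix.mul_assoc]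
  rw [adj, this]

/-- Stabilizability bounds the value functions uniformly in the horizon. -/
theorem exists_ric_le (hQ : Q.PosSemidef) (hR : R.PosDef) (hstab : Stabilizable A B) :
    ∃ C : ℝ, 0 < C ∧ ∀ k x, x ⬝ᵥ (ric A B Q R k *ᵥ x) ≤ C * (x ⬝ᵥ x) := by
  open scoped Matrix.Norms.L2Operator in
  obtain ⟨K, hK⟩ := hstab
  set F := A + B * K with hF
  have hlim : Tendsto (fun t : ℕ => F ^ t) atTop (𝓝 0) := by
    refine tendsto_pi_nhds.2 fun i => tendsto_pi_nhds.2 fun j => ?_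
    have := (tendsto_pi_nhds.1 (hK (Pi.single j 1))) i
    simpa using this
  have hlim2 := (tendsto_zero_iff_norm_tendsto_zero.1 hlim)
  obtain ⟨s, hs⟩ := (hlim2.eventually (gt_mem_nhds (show (0 : ℝ) < 1 / 2 by norm_num))).exists
  set q := ‖Q + Kᵀ * R * K‖
  have hs2 : ∀ x, ((F ^ s) *ᵥ x) ⬝ᵥ ((F ^ s) *ᵥ x) ≤ 1 / 2 * (x ⬝ᵥ x) := by
    intro x
    have h1 := norm_toLp_mulVec_le (F ^ s) x
    rw [← norm_toLp_sq, ← norm_toLp_sq]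
    have h2 := norm_nonneg (WithLp.toLp 2 x)
    have h3 := norm_nonneg (WithLp.toLp 2 ((F ^ s) *ᵥ x))
    have h4 : ‖WithLp.toLp 2 ((F ^ s) *ᵥ x)‖ ≤ 1 / 2 * ‖WithLp.toLp 2 x‖ := by nlinarith
    nlinarith
  -- A Lyapunov function for the stabilized loop: $X(x)-X(Fx)=2q(|x|^2-|F^sx|^2)\ge q|x|^2$, which
  -- pays for the running cost of the feedback $K$.
  let X : (Fin n → ℝ) → ℝ := fun x =>
    2 * q * ∑ i ∈ Finset.range s, ((F ^ i) *ᵥ x) ⬝ᵥ ((F ^ i) *ᵥ x)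
  have hX : ∀ x, q * (x ⬝ᵥ x) + X (F *ᵥ x) ≤ X x := by
    intro x
    have h1 : ∑ i ∈ Finset.range s, ((F ^ i) *ᵥ (F *ᵥ x)) ⬝ᵥ ((F ^ i) *ᵥ (F *ᵥ x))
        = ∑ i ∈ Finset.range s, ((F ^ i) *ᵥ x) ⬝ᵥ ((F ^ i) *ᵥ x)
          + ((F ^ s) *ᵥ x) ⬝ᵥ ((F ^ s) *ᵥ x) - x ⬝ᵥ x := by
      rw [← Finset.sum_range_succ, Finset.sum_range_succ']
      simp [mulVec_mulVec, pow_succ]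
    simp only [X, h1]
    have hq : 0 ≤ q := norm_nonneg _
    nlinarith [hs2 x]
  have hV : ∀ k x, x ⬝ᵥ (ric A B Q R k *ᵥ x) ≤ X x := by
    intro k
    induction k with
    | zero =>
      intro x
      simp only [ric, zero_mulVec, dotProduct_zero]
      have : 0 ≤ q := norm_nonneg _
      exact mul_nonneg (by positivity) (Finset.sum_nonneg fun i _ => dotProduct_self_nonneg' _)
    | succ k ih =>
      intro x
      have h1 := riccatiStep_le (A := A) (B := B) (Q := Q) hR
        (posSemidef_ric (A := A) (B := B) hQ hR k) x (K *ᵥ x)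
      have h2 : A *ᵥ x + B *ᵥ (K *ᵥ x) = F *ᵥ x := by
        rw [hF, add_mulVec, mulVec_mulVec]
      have h3 : x ⬝ᵥ (Q *ᵥ x) + (K *ᵥ x) ⬝ᵥ (R *ᵥ (K *ᵥ x)) ≤ q * (x ⬝ᵥ x) := by
        refine le_trans (le_of_eq ?_) (dotProduct_mulVec_le (Q + Kᵀ * R * K) x)
        rw [add_mulVec, dotProduct_add, ← mulVec_mulVec, ← mulVec_mulVec,
          dotProduct_transpose_mulVec]
      rw [h2] at h1
      exact h1.trans ((add_le_add h3 (ih _)).trans (hX x))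
  refine ⟨2 * q * ∑ i ∈ Finset.range s, ‖F ^ i‖ ^ 2 + 1, by positivity, fun k x =>
    (hV k x).trans ?_⟩
  have h5 : ∀ i ∈ Finset.range s, ((F ^ i) *ᵥ x) ⬝ᵥ ((F ^ i) *ᵥ x) ≤ ‖F ^ i‖ ^ 2 * (x ⬝ᵥ x) := by
    intro i _
    rw [← norm_toLp_sq, ← norm_toLp_sq, ← mul_pow]
    exact pow_le_pow_left₀ (norm_nonneg _) (norm_toLp_mulVec_le _ _) 2
  have h6 := Finset.sum_le_sum h5
  rw [← Finset.sum_mul] at h6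
  have h7 := dotProduct_self_nonneg' x
  have hq : 0 ≤ q := norm_nonneg _
  calc X x ≤ 2 * q * ((∑ i ∈ Finset.range s, ‖F ^ i‖ ^ 2) * (x ⬝ᵥ x)) :=
        mul_le_mul_of_nonneg_left h6 (by positivity)
    _ ≤ _ := by nlinarith

theorem sqrt_mulVec_eq_zero (hQ : Q.PosSemidef) {x : Fin n → ℝ} (h : x ⬝ᵥ (Q *ᵥ x) = 0) :
    CFC.sqrt Q *ᵥ x = 0 := by
  have h0 : (CFC.sqrt Q).PosSemidef := Matrix.nonneg_iff_posSemidef.1 (CFC.sqrt_nonneg Q)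
  have h1 : CFC.sqrt Q * CFC.sqrt Q = Q :=
    CFC.sqrt_mul_sqrt_self Q (Matrix.nonneg_iff_posSemidef.2 hQ)
  have hs := (posSemidef_iff_real.1 h0).1
  rw [← h1, ← mulVec_mulVec] at h
  conv at h => lhs; arg 2; rw [← hs]
  rw [dotProduct_transpose_mulVec, hs] at h
  exact dotProduct_self_eq_zero.1 h

/-- Zero optimal cost forces $u=0$, since $R>0$, and zero output at the first step. The optimal
trajectory is then the uncontrolled one, and the argument repeats from $Ax$. -/
theorem output_eq_zero_of_ric (hQ : Q.PosSemidef) (hR : R.PosDef) (k : ℕ) (x : Fin n → ℝ)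
    (h : x ⬝ᵥ (ric A B Q R k *ᵥ x) = 0) : ∀ i < k, CFC.sqrt Q *ᵥ ((A ^ i) *ᵥ x) = 0 := by
  induction k generalizing x with
  | zero => intro i hi; omega
  | succ k ih =>
    obtain ⟨u, hu, he⟩ := exists_riccatiStep_eq (A := A) (B := B) (Q := Q) hR
      (posSemidef_ric hQ hR k) x
    have h1 := (posSemidef_iff_real.1 hQ).2 x
    have h2 := (posSemidef_iff_real.1 hR.posSemidef).2 u
    have h3 := dotProduct_ric_nonneg (A := A) (B := B) hQ hR k
      (closedLoop A B R (ric A B Q R k) *ᵥ x)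
    rw [ric, he] at h
    have hu0 : u = 0 := by
      by_contra hne
      have : 0 < u ⬝ᵥ (R *ᵥ u) := by simpa using hR.dotProduct_mulVec_pos hne
      linarith
    rw [hu0, mulVec_zero, add_zero] at hu
    rw [← hu] at h h3
    intro i hi
    rcases i with _ | i
    · simpa using sqrt_mulVec_eq_zero hQ (x := x) (by linarith)
    · have := ih (A *ᵥ x) (by linarith) i (by omega)
      rwa [mulVec_mulVec _ (A ^ i) A, ← pow_succ] at this

/-- An observable system shows every nonzero initial state within a fixed number of steps. -/
theorem exists_observability_index {q : ℕ} {C : Matrix (Fin q) (Fin n) ℝ} (h : Observable A C) :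
    ∃ N : ℕ, ∀ x, (∀ i < N, C *ᵥ ((A ^ i) *ᵥ x) = 0) → x = 0 := by
  let W : ℕ → Submodule ℝ (Fin n → ℝ) := fun k =>
    { carrier := {x | ∀ i < k, C *ᵥ ((A ^ i) *ᵥ x) = 0}
      zero_mem' := by intro i _; simp
      add_mem' := by
        intro a b ha hb i hi
        simp [mulVec_add, ha i hi, hb i hi]
      smul_mem' := by
        intro c a ha i hi
        simp [mulVec_smul, ha i hi] }
  -- The subspaces of states with no output during $k$ steps decrease in $k$, hence are eventually
  -- constant.
  obtain ⟨N, hN⟩ := IsArtinian.monotone_stabilizes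
    (⟨fun k => OrderDual.toDual (W k), fun a b hab x hx i hi => hx i (hi.trans_le hab)⟩ :
      ℕ →o (Submodule ℝ (Fin n → ℝ))ᵒᵈ)
  refine ⟨N, fun x hx => h x fun t => ?_⟩
  have h1 : W N = W (max N (t + 1)) := hN _ (le_max_left _ _)
  have h2 : x ∈ W N := hx
  rw [h1] at h2
  exact h2 t (by omega)

/-- A state with zero $N$-step value has no output for $N$ steps, so it is zero when $N$ is the
observability index; the form is then positive definite. -/
theorem exists_le_ric (hQ : Q.PosSemidef) (hR : R.PosDef) (hobs : Observable A (CFC.sqrt Q)) :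
    ∃ (N : ℕ) (c : ℝ), 0 < c ∧ ∀ x, c * (x ⬝ᵥ x) ≤ x ⬝ᵥ (ric A B Q R N *ᵥ x) := by
  obtain ⟨N, hN⟩ := exists_observability_index hobs
  exact ⟨N, exists_le_of_posDef (posDef_of_pos (posSemidef_ric hQ hR N) fun x hx =>
    hN x (output_eq_zero_of_ric hQ hR N x hx))⟩

end Invariant

/-! ### Uniform bounds on $P$, $L$, $\Upsilon^{-1}$ and $D$. -/

section Bounds

open scoped Matrix.Norms.L2Operator

variable {n m : ℕ} {A : Matrix (Fin n) (Fin n) ℝ} {B : Matrix (Fin n) (Fin m) ℝ}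
  {Q : Matrix (Fin n) (Fin n) ℝ} {R : Matrix (Fin m) (Fin m) ℝ}

/-- A discounted sum of value functions grows along a trajectory unless the running cost is
large. -/
theorem discounted_ric_growth (hQ : Q.PosSemidef) (hR : R.PosDef) (N : ℕ) (x : Fin n → ℝ)
    (u : Fin m → ℝ) :
    2 * ∑ i ∈ Finset.range (N + 1), (1 / 2 : ℝ) ^ i * (x ⬝ᵥ (ric A B Q R i *ᵥ x))
        + (1 / 2 : ℝ) ^ N * (x ⬝ᵥ (ric A B Q R (N + 1) *ᵥ x))
      ≤ ∑ i ∈ Finset.range (N + 1), (1 / 2 : ℝ) ^ i *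
          ((A *ᵥ x + B *ᵥ u) ⬝ᵥ (ric A B Q R i *ᵥ (A *ᵥ x + B *ᵥ u)))
        + (2 - (1 / 2 : ℝ) ^ N) * (x ⬝ᵥ (Q *ᵥ x) + u ⬝ᵥ (R *ᵥ u)) := by
  have step : ∀ k, x ⬝ᵥ (ric A B Q R (k + 1) *ᵥ x) ≤ x ⬝ᵥ (Q *ᵥ x) + u ⬝ᵥ (R *ᵥ u)
      + (A *ᵥ x + B *ᵥ u) ⬝ᵥ (ric A B Q R k *ᵥ (A *ᵥ x + B *ᵥ u)) := fun k =>
    riccatiStep_le (A := A) (B := B) (Q := Q) hR (posSemidef_ric (A := A) (B := B) hQ hR k) x u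
  -- The claim is the sum over $i\le N$ of $2^{-i}$ times `step i`. Since the value function with no
  -- steps left is zero, shifting the index doubles the sum on the left.
  induction N with
  | zero =>
    have := step 0
    have h0 : ∀ y : Fin n → ℝ, y ⬝ᵥ (ric A B Q R 0 *ᵥ y) = 0 := fun y => by simp [ric]
    rw [h0] at this
    simp only [zero_add, Finset.sum_range_one, h0]
    norm_num
    linarith
  | succ N ih =>
    rw [Finset.sum_range_succ, Finset.sum_range_succ (n := N + 1)]
    have h1 := mul_le_mul_of_nonneg_left (step (N + 1))
      (show (0 : ℝ) ≤ (1 / 2) ^ (N + 1) by positivity)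
    have h2 : (1 / 2 : ℝ) ^ N = 2 * (1 / 2) ^ (N + 1) := by rw [pow_succ]; ring
    rw [h2] at ih
    linarith

theorem exists_norm_ric_le (hQ : Q.PosSemidef) (hR : R.PosDef) (hstab : Stabilizable A B) :
    ∃ C : ℝ, 0 < C ∧ ∀ k, ‖ric A B Q R k‖ ≤ C := by
  obtain ⟨C, hC, h⟩ := exists_ric_le (A := A) (B := B) hQ hR hstab
  exact ⟨C, hC, fun k => norm_le_of_posSemidef (posSemidef_ric hQ hR k) hC.le (h k)⟩

/-- A family of forms, comparable to the square of the norm, that contracts along the optimal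
closed loops. -/
theorem exists_contracting_forms (hQ : Q.PosSemidef) (hR : R.PosDef) (hstab : Stabilizable A B)
    (hobs : Observable A (CFC.sqrt Q)) :
    ∃ (N : ℕ) (Y : ℕ → (Fin n → ℝ) → ℝ) (c C ρ : ℝ), 0 < c ∧ 0 ≤ C ∧ 0 ≤ ρ ∧ ρ < 1 ∧
      (∀ j x, c * (x ⬝ᵥ x) ≤ Y j x) ∧ (∀ j x, Y j x ≤ C * (x ⬝ᵥ x)) ∧
      ∀ j x, Y j (closedLoop A B R (ric A B Q R (N + j)) *ᵥ x) ≤ ρ * Y (j + 1) x := by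
  obtain ⟨N, c, hc, hcN⟩ := exists_le_ric (A := A) (B := B) hQ hR hobs
  obtain ⟨C, hC, hCk⟩ := exists_ric_le (A := A) (B := B) hQ hR hstab
  have hV0 := dotProduct_ric_nonneg (A := A) (B := B) hQ hR
  let Z : (Fin n → ℝ) → ℝ := fun x =>
    ∑ i ∈ Finset.range (N + 1), (1 / 2 : ℝ) ^ i * (x ⬝ᵥ (ric A B Q R i *ᵥ x))
  set c' := (1 / 2 : ℝ) ^ N * c with hc'
  have hc'0 : 0 < c' := by positivity
  have hZlow : ∀ x, c' * (x ⬝ᵥ x) ≤ Z x := fun x => by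
    have h1 : (1 / 2 : ℝ) ^ N * (x ⬝ᵥ (ric A B Q R N *ᵥ x)) ≤ Z x :=
      Finset.single_le_sum (f := fun i => (1 / 2 : ℝ) ^ i * (x ⬝ᵥ (ric A B Q R i *ᵥ x)))
        (fun i _ => mul_nonneg (by positivity) (hV0 i x)) (Finset.self_mem_range_succ N)
    refine le_trans ?_ h1
    rw [hc', mul_assoc]
    exact mul_le_mul_of_nonneg_left (hcN x) (by positivity)
  have hZup : ∀ x, Z x ≤ (N + 1) * C * (x ⬝ᵥ x) := fun x => by
    have : Z x ≤ ∑ i ∈ Finset.range (N + 1), C * (x ⬝ᵥ x) := by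
      refine Finset.sum_le_sum fun i _ => ?_
      have h1 : (1 / 2 : ℝ) ^ i ≤ 1 := pow_le_one₀ (by norm_num) (by norm_num)
      nlinarith [hV0 i x, hCk i x]
    simpa [mul_assoc] using this
  have hZ0 : ∀ x, 0 ≤ Z x := fun x =>
    (mul_nonneg hc'0.le (dotProduct_self_nonneg' x)).trans (hZlow x)
  -- The bound $a\ge2$ serves the decrease `hdec`; $ac\ge(N+1)C+c'$ serves the lower bound of $Y_0$.
  set a := 2 + ((N + 1) * C + c') / c with ha
  have ha2 : 2 ≤ a := by rw [ha]; have : 0 ≤ ((N + 1) * C + c') / c := by positivity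
                         linarith
  have hac : ((N + 1) * C + c') ≤ a * c := by
    rw [ha, add_mul 2, div_mul_cancel₀ _ hc.ne']; linarith
  -- The value function alone decreases only by the running cost, which need not control $x$ when
  -- $Q$ is singular. With $y$ the closed-loop successor of $x$ and $\ell$ the running cost,
  -- subtracting $Z$ helps: $Y_{j+1}(x)-Y_j(y)=a\ell+Z(y)-Z(x)\ge(a-2)\ell+Z(x)\ge c'|x|^2$.
  let Y : ℕ → (Fin n → ℝ) → ℝ := fun j x => a * (x ⬝ᵥ (ric A B Q R (N + j) *ᵥ x)) - Z x
  have hdec : ∀ j x, Y j (closedLoop A B R (ric A B Q R (N + j)) *ᵥ x) + c' * (x ⬝ᵥ x)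
      ≤ Y (j + 1) x := by
    intro j x
    obtain ⟨u, hu, he⟩ := exists_riccatiStep_eq (A := A) (B := B) (Q := Q) hR
      (posSemidef_ric (A := A) (B := B) hQ hR (N + j)) x
    have h1 := discounted_ric_growth (A := A) (B := B) hQ hR N x u
    rw [hu] at h1
    have h2 := (posSemidef_iff_real.1 hQ).2 x
    have h3 := (posSemidef_iff_real.1 hR.posSemidef).2 u
    have h4 : 0 ≤ (1 / 2 : ℝ) ^ N * (x ⬝ᵥ (ric A B Q R (N + 1) *ᵥ x)) :=
      mul_nonneg (by positivity) (hV0 _ x)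
    have h5 : (0 : ℝ) ≤ (1 / 2) ^ N * (x ⬝ᵥ (Q *ᵥ x) + u ⬝ᵥ (R *ᵥ u)) := by positivity
    have h6 : 0 ≤ (a - 2) * (x ⬝ᵥ (Q *ᵥ x) + u ⬝ᵥ (R *ᵥ u)) :=
      mul_nonneg (by linarith) (by positivity)
    have h7 := hZlow x
    have h8 : x ⬝ᵥ (ric A B Q R (N + (j + 1)) *ᵥ x) = x ⬝ᵥ (Q *ᵥ x) + u ⬝ᵥ (R *ᵥ u)
        + (closedLoop A B R (ric A B Q R (N + j)) *ᵥ x) ⬝ᵥ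
          (ric A B Q R (N + j) *ᵥ (closedLoop A B R (ric A B Q R (N + j)) *ᵥ x)) := he
    simp only [Y, h8]
    simp only [Z] at h7 ⊢
    linarith
  -- The decrease propagates positivity from $j$ to $j+1$, so only $j=0$ needs the size of $a$.
  have hlow : ∀ j x, c' * (x ⬝ᵥ x) ≤ Y j x := by
    intro j
    induction j with
    | zero =>
      intro x
      simp only [Y, add_zero]
      have h1 := hZup x
      have h2 := mul_le_mul_of_nonneg_left (hcN x) (show 0 ≤ a by linarith)
      have h3 := mul_le_mul_of_nonneg_right hac (dotProduct_self_nonneg' x)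
      linarith
    | succ j ih =>
      intro x
      have := mul_nonneg hc'0.le
        (dotProduct_self_nonneg' (closedLoop A B R (ric A B Q R (N + j)) *ᵥ x))
      linarith [hdec j x, ih (closedLoop A B R (ric A B Q R (N + j)) *ᵥ x)]
  set C' := a * C + c' with hC'
  have hC'0 : 0 < C' := by positivity
  have hup : ∀ j x, Y j x ≤ C' * (x ⬝ᵥ x) := by
    intro j x
    have h1 := mul_le_mul_of_nonneg_left (hCk (N + j) x) (show 0 ≤ a by linarith)
    have h2 := hZ0 x
    have h3 := mul_nonneg hc'0.le (dotProduct_self_nonneg' x)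
    simp only [Y, hC']
    linarith
  refine ⟨N, Y, c', C', 1 - c' / C', hc'0, hC'0.le, ?_, ?_, hlow, hup, fun j x => ?_⟩
  · rw [sub_nonneg, div_le_one hC'0, hC']
    have : 0 ≤ a * C := by positivity
    linarith
  · have : 0 < c' / C' := by positivity
    linarith
  · have h1 := hdec j x
    have h2 := mul_le_mul_of_nonneg_left (hup (j + 1) x) (show 0 ≤ c' / C' by positivity)
    have h3 : c' / C' * (C' * (x ⬝ᵥ x)) = c' * (x ⬝ᵥ x) := by field_simp
    linarith

/-- The adjoint recursion is measured in the norms $\sqrt{Y_j}$, where the closed loop contracts by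
$\rho<1$. Each step adds a bounded Riccati term, as in a geometric series. -/
theorem exists_norm_adj_le (hQ : Q.PosSemidef) (hR : R.PosDef) (hstab : Stabilizable A B)
    (hobs : Observable A (CFC.sqrt Q)) :
    ∃ C : ℝ, 0 ≤ C ∧ ∀ k, ‖adj A B Q R k‖ ≤ C := by
  obtain ⟨p, hp, hP⟩ := exists_norm_ric_le (A := A) (B := B) hQ hR hstab
  obtain ⟨N, Y, c, C, r, hc, hC, hr0, hr1, hlow, hup, hdec⟩ :=
    exists_contracting_forms hQ hR hstab hobs
  set ρ := √r with hρ
  have hρ1 : ρ < 1 := by rw [hρ, Real.sqrt_lt' one_pos]; simpa using hr1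
  have hρ0 : 0 ≤ ρ := Real.sqrt_nonneg _
  have hsc : 0 < √c := Real.sqrt_pos.2 hc
  have hnorm : ∀ j x, ‖WithLp.toLp 2 x‖ ≤ √(Y j x) / √c := by
    intro j x
    rw [le_div_iff₀ hsc]
    refine Real.le_sqrt_of_sq_le ?_
    rw [mul_pow, Real.sq_sqrt hc.le, norm_toLp_sq, mul_comm]
    exact hlow j x
  -- The first summand makes $\beta$ stable under $\beta\mapsto(p/\sqrt c+\beta)\rho$; the second
  -- covers the start at index $N$.
  set β := p / √c / (1 - ρ) + ‖adj A B Q R N‖ / √c with hβ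
  have hβ0 : 0 ≤ β := by
    have : 0 < 1 - ρ := by linarith
    positivity
  have hβρ : (p / √c + β) * ρ ≤ β := by
    have h1 : 0 < 1 - ρ := by linarith
    have h2 : p / √c ≤ β * (1 - ρ) := by
      rw [hβ, add_mul, div_mul_cancel₀ _ h1.ne']
      have : 0 ≤ ‖adj A B Q R N‖ / √c * (1 - ρ) := by positivity
      linarith
    have h3 : p / √c * ρ ≤ p / √c := mul_le_of_le_one_right (by positivity) hρ1.le
    linarith
  have key : ∀ j x, ‖WithLp.toLp 2 ((adj A B Q R (N + j))ᵀ *ᵥ x)‖ ≤ β * √(Y j x) := by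
    intro j
    induction j with
    | zero =>
      intro x
      refine (norm_toLp_mulVec_le _ x).trans ?_
      rw [norm_transpose_eq, add_zero]
      calc ‖adj A B Q R N‖ * ‖WithLp.toLp 2 x‖ ≤ ‖adj A B Q R N‖ * (√(Y 0 x) / √c) :=
            mul_le_mul_of_nonneg_left (hnorm 0 x) (norm_nonneg _)
        _ = ‖adj A B Q R N‖ / √c * √(Y 0 x) := by ring
        _ ≤ β * √(Y 0 x) := by
            refine mul_le_mul_of_nonneg_right ?_ (Real.sqrt_nonneg _)
            have h1 : 0 < 1 - ρ := by linarith
            have : 0 ≤ p / √c / (1 - ρ) := by positivity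
            linarith
    | succ j ih =>
      intro x
      have hPs := (posSemidef_iff_real.1
        (posSemidef_ric (A := A) (B := B) (Q := Q) (R := R) hQ hR (N + j))).1
      set y := closedLoop A B R (ric A B Q R (N + j)) *ᵥ x with hy
      have h1 : (adj A B Q R (N + (j + 1)))ᵀ *ᵥ x
          = ric A B Q R (N + j) *ᵥ y + (adj A B Q R (N + j))ᵀ *ᵥ y := by
        rw [← add_assoc, adj_succ_eq hQ hR, transpose_mul, transpose_transpose, transpose_add, hPs,
          ← mulVec_mulVec, add_mulVec]
      have h2 : √(Y j y) ≤ ρ * √(Y (j + 1) x) := by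
        rw [hρ, ← Real.sqrt_mul hr0]
        exact Real.sqrt_le_sqrt (hdec j x)
      have h3 := norm_toLp_mulVec_le (ric A B Q R (N + j)) y
      have h4 : ‖ric A B Q R (N + j)‖ * ‖WithLp.toLp 2 y‖ ≤ p * (√(Y j y) / √c) :=
        mul_le_mul (hP _) (hnorm j y) (norm_nonneg _) hp.le
      rw [h1, WithLp.toLp_add]
      calc _ ≤ p * (√(Y j y) / √c) + β * √(Y j y) :=
            (norm_add_le _ _).trans (add_le_add (h3.trans h4) (ih y))
        _ = (p / √c + β) * √(Y j y) := by ring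
        _ ≤ (p / √c + β) * (ρ * √(Y (j + 1) x)) :=
            mul_le_mul_of_nonneg_left h2 (by positivity)
        _ = ((p / √c + β) * ρ) * √(Y (j + 1) x) := by ring
        _ ≤ β * √(Y (j + 1) x) := mul_le_mul_of_nonneg_right hβρ (Real.sqrt_nonneg _)
  have hlarge : ∀ j, ‖adj A B Q R (N + j)‖ ≤ β * √C := by
    intro j
    rw [← norm_transpose_eq]
    refine norm_le_of_norm_mulVec_le (by positivity) fun x => (key j x).trans ?_
    rw [mul_assoc]
    refine mul_le_mul_of_nonneg_left ?_ hβ0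
    refine (Real.sqrt_le_sqrt (hup j x)).trans (le_of_eq ?_)
    rw [Real.sqrt_mul hC, ← norm_toLp_sq, Real.sqrt_sq (norm_nonneg _)]
  -- The contracting forms say nothing about indices below $N$; those finitely many norms are added.
  refine ⟨∑ i ∈ Finset.range N, ‖adj A B Q R i‖ + β * √C, by positivity, fun k => ?_⟩
  rcases lt_or_ge k N with hk | hk
  · have := Finset.single_le_sum (f := fun i => ‖adj A B Q R i‖) (fun i _ => norm_nonneg _)
      (Finset.mem_range.2 hk)
    have h2 : 0 ≤ β * √C := by positivity
    linarith
  · obtain ⟨j, rfl⟩ := Nat.exists_eq_add_of_le hk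
    have h2 : 0 ≤ ∑ i ∈ Finset.range N, ‖adj A B Q R i‖ := by positivity
    linarith [hlarge j]

/-- The inverse of a positive definite matrix plus any positive semidefinite one is bounded. -/
theorem exists_norm_inv_add_le (hR : R.PosDef) :
    ∃ C : ℝ, 0 ≤ C ∧ ∀ M : Matrix (Fin m) (Fin m) ℝ, M.PosSemidef → ‖(R + M)⁻¹‖ ≤ C := by
  obtain ⟨c, hc, h⟩ := exists_le_of_posDef hR
  refine ⟨1 / c, by positivity, fun M hM => norm_le_of_norm_mulVec_le (by positivity) fun x => ?_⟩
  have hu : IsUnit (R + M).det := (isUnit_iff_isUnit_det _).1 (hR.add_posSemidef hM).isUnit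
  -- Here $c|z|^2\le z'Rz\le z'(R+M)z=z'x\le|z||x|$.
  set z := (R + M)⁻¹ *ᵥ x with hz
  have h1 : (R + M) *ᵥ z = x := by rw [hz, mulVec_mulVec, mul_nonsing_inv _ hu, one_mulVec]
  have h2 : z ⬝ᵥ x = z ⬝ᵥ (R *ᵥ z) + z ⬝ᵥ (M *ᵥ z) := by
    rw [← dotProduct_add, ← add_mulVec, h1]
  have h3 := (posSemidef_iff_real.1 hM).2 z
  have h4 := dotProduct_le_norm z x
  have h5 := h z
  rw [← norm_toLp_sq] at h5
  rw [div_mul_eq_mul_div, one_mul, le_div_iff₀ hc]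
  rcases (norm_nonneg (WithLp.toLp 2 z)).eq_or_lt with h0 | h0
  · rw [← h0]; simp
  · nlinarith

/-- The matrices `D_T(t)` are bounded uniformly in `t ≤ T`. -/
theorem exists_matD_le (hQ : Q.PosSemidef) (hR : R.PosDef) (hstab : Stabilizable A B)
    (hobs : Observable A (CFC.sqrt Q)) :
    ∃ C : ℝ, 0 ≤ C ∧ ∀ T t x,
      x ⬝ᵥ (matD A B (fun _ => Q) (fun _ => R) 0 T t *ᵥ x) ≤ C * (x ⬝ᵥ x) := by
  obtain ⟨p, hp, hP⟩ := exists_norm_ric_le (A := A) (B := B) hQ hR hstab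
  obtain ⟨l, hl, hL⟩ := exists_norm_adj_le (A := A) (B := B) hQ hR hstab hobs
  obtain ⟨r, hr, hΥ⟩ := exists_norm_inv_add_le hR
  refine ⟨(p + l) * ‖B‖ * r * ‖B‖ * (p + l), by positivity, fun T t x =>
    (dotProduct_mulVec_le _ x).trans
      (mul_le_mul_of_nonneg_right ?_ (dotProduct_self_nonneg' x))⟩
  rw [matD, upsilon, riccatiP, adjointL, riccatiBack_eq, adjointBack_eq]
  set k := T + 1 - (t + 1)
  have h1 : ‖ric A B Q R k + adj A B Q R k‖ ≤ p + l :=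
    (norm_add_le _ _).trans (add_le_add (hP k) (hL k))
  have h2 : ‖(R + Bᵀ * ric A B Q R k * B)⁻¹‖ ≤ r := hΥ _ (by
    simpa [conjTranspose_eq_transpose_of_trivial] using
      (posSemidef_ric (A := A) (B := B) (Q := Q) (R := R) hQ hR k).conjTranspose_mul_mul_same B)
  have h1' := norm_transpose_eq (ric A B Q R k + adj A B Q R k)
  have hB := norm_transpose_eq B
  refine (l2_opNorm_mul _ _).trans (mul_le_mul ?_ h1 (norm_nonneg _) (by positivity))
  refine (l2_opNorm_mul _ _).trans (mul_le_mul ?_ hB.le (norm_nonneg _) (by positivity))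
  refine (l2_opNorm_mul _ _).trans (mul_le_mul ?_ h2 (norm_nonneg _) (by positivity))
  exact (l2_opNorm_mul _ _).trans (mul_le_mul (h1'.trans_le h1) le_rfl (norm_nonneg _)
    (by positivity))

end Bounds

/-! ### Square integrability of vector-valued functions. -/

section Integrability

variable {n m : ℕ} {Ω : Type*} [MeasurableSpace Ω] {μ : Measure Ω}

theorem memLp_mulVec (M : Matrix (Fin n) (Fin m) ℝ) {x : Ω → Fin m → ℝ} (hx : MemLp x 2 μ) :
    MemLp (fun ω => M *ᵥ x ω) 2 μ := by
  rw [memLp_pi_iff] at hx ⊢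
  intro i
  simp only [mulVec, dotProduct]
  exact memLp_finsetSum _ fun j _ => (hx j).const_mul _

theorem integrable_dotProduct {x y : Ω → Fin n → ℝ} (hx : MemLp x 2 μ) (hy : MemLp y 2 μ) :
    Integrable (fun ω => x ω ⬝ᵥ y ω) μ := by
  rw [memLp_pi_iff] at hx hy
  exact integrable_finsetSum _ fun j _ => (hx j).integrable_mul (hy j)

theorem integral_dotProduct {x y : Ω → Fin n → ℝ} (hx : MemLp x 2 μ) (hy : MemLp y 2 μ) :
    ∫ ω, x ω ⬝ᵥ y ω ∂μ = ∑ a, ∫ ω, x ω a * y ω a ∂μ := by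
  rw [memLp_pi_iff] at hx hy
  exact integral_finsetSum _ fun j _ => (hx j).integrable_mul (hy j)

theorem measurable_mulVec (M : Matrix (Fin n) (Fin m) ℝ) :
    Measurable fun x : Fin m → ℝ => M *ᵥ x :=
  (continuous_const.matrix_mulVec continuous_id).measurable

end Integrability

/-! The noise. -/

section Noise

variable {n M : ℕ} {Ω : Type*} {v : Fin M → Fin n → ℝ} {p : Fin M → ℝ} {w : ℕ → Ω → Fin n → ℝ}

/-- The observed value of the noise, expanded in the list of its possible values. -/
noncomputable def observedNoise (v : Fin M → Fin n → ℝ) (w : ℕ → Ω → Fin n → ℝ) (t : ℕ) (ω : Ω) : Fin n → ℝ :=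
  valueMatrix v *ᵥ obs v w t ω

theorem obs_mem_Icc (t : ℕ) (ω : Ω) (j : Fin M) : obs v w t ω j ∈ Set.Icc (0 : ℝ) 1 := by
  unfold obs; split_ifs <;> simp

open Classical in
theorem measurable_obs_law (v : Fin M → Fin n → ℝ) :
    Measurable fun y : Fin n → ℝ => (fun j => if y = v j then (1 : ℝ) else 0) :=
  measurable_pi_lambda _ fun j =>
    Measurable.ite (measurableSet_singleton (v j)) measurable_const measurable_const

/-- Measurability with respect to $\sigma(w(t))$ alone yields both the adaptedness of the estimate
and independence across times. -/
theorem measurable_comap_observedNoise (t : ℕ) :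
    Measurable[MeasurableSpace.comap (w t) inferInstance] (observedNoise v w t) :=
  ((measurable_mulVec _).comp (measurable_obs_law v)).comp (comap_measurable (w t))

theorem abs_observedNoise_le (t : ℕ) (ω : Ω) (a : Fin n) :
    |observedNoise v w t ω a| ≤ ∑ j, |v j a| := by
  refine (Finset.abs_sum_le_sum_abs (fun j => valueMatrix v a j * obs v w t ω j)
    Finset.univ).trans (Finset.sum_le_sum fun j _ => ?_)
  have h := obs_mem_Icc (v := v) (w := w) t ω j
  rw [abs_mul, abs_of_nonneg h.1]
  exact mul_le_of_le_one_right (abs_nonneg _) h.2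

theorem measurable_history_apply {s t : ℕ} (h : s < t) : Measurable[history w t] (w s) :=
  Measurable.mono (comap_measurable (w s))
    (le_iSup₂_of_le (f := fun s (_ : s < t) => MeasurableSpace.comap (w s) inferInstance)
      s h le_rfl) le_rfl

theorem history_mono {s t : ℕ} (h : s ≤ t) : history w s ≤ history w t :=
  iSup₂_le fun r hr => le_iSup₂_of_le
    (f := fun s (_ : s < t) => MeasurableSpace.comap (w s) inferInstance) r (hr.trans_le h) le_rfl

theorem meanEstimate_zero (ω : Ω) : meanEstimate v w 0 ω = 0 := by
  simp [meanEstimate, lmmsue]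

theorem meanEstimate_of_pos {t : ℕ} (ht : t ≠ 0) (ω : Ω) :
    meanEstimate v w t ω = (1 / (t : ℝ)) • ∑ i ∈ Finset.range t, observedNoise v w i ω := by
  simp only [meanEstimate, lmmsue, if_neg ht, mulVec_smul, observedNoise, mulVec_sum]

theorem measurable_meanEstimate (t : ℕ) : Measurable[history w t] (meanEstimate v w t) := by
  rcases eq_or_ne t 0 with rfl | ht
  · have : meanEstimate v w 0 = fun _ => 0 := funext meanEstimate_zero
    rw [this]
    exact measurable_const
  · have : meanEstimate v w t
        = fun ω => (1 / (t : ℝ)) • ∑ i ∈ Finset.range t, observedNoise v w i ω :=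
      funext (meanEstimate_of_pos ht)
    rw [this]
    have h : ∀ i ∈ Finset.range t, Measurable[history w t] (observedNoise v w i) := fun i hi =>
      (measurable_comap_observedNoise i).mono
        (measurable_history_apply (Finset.mem_range.1 hi)).comap_le le_rfl
    let _ : MeasurableSpace Ω := history w t
    exact (Finset.measurable_fun_sum _ h).const_smul (1 / (t : ℝ))

variable [mΩ : MeasurableSpace Ω] {μ : Measure Ω}

theorem memLp_of_bound_apply [IsFiniteMeasure μ] {x : Ω → Fin n → ℝ} (hx : Measurable x)
    (K : Fin n → ℝ) (h : ∀ ω a, |x ω a| ≤ K a) : MemLp x 2 μ :=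
  memLp_pi_iff.2 fun a => MemLp.of_bound ((measurable_pi_apply a).comp hx).aestronglyMeasurable
    (K a) (ae_of_all _ fun ω => h ω a)

namespace IsNoise

theorem measurable_observedNoise (hw : IsNoise μ v p w) (t : ℕ) :
    Measurable (observedNoise v w t) :=
  measurable_comap_observedNoise t |>.mono (hw.measurable t).comap_le le_rfl

theorem measurableSet_eq (hw : IsNoise μ v p w) (t : ℕ) (j : Fin M) :
    MeasurableSet {ω | w t ω = v j} :=
  hw.measurable t (measurableSet_singleton (v j))

theorem integral_obs (hw : IsNoise μ v p w) (t : ℕ) (j : Fin M) :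
    ∫ ω, obs v w t ω j ∂μ = p j := by
  classical
  have : (fun ω => obs v w t ω j) = {ω | w t ω = v j}.indicator 1 := by
    ext ω
    simp [obs, Set.indicator_apply]
  rw [this, integral_indicator_one (hw.measurableSet_eq t j), hw.law]

theorem indep_history (hw : IsNoise μ v p w) (t : ℕ) :
    Indep (history w t) (MeasurableSpace.comap (w t) inferInstance) μ := by
  have h := indep_iSup_of_disjoint (m := fun s => MeasurableSpace.comap (w s) inferInstance)
    (fun s => (hw.measurable s).comap_le) hw.indep (S := {s | s < t}) (T := {t})
    (by simp)
  simpa using h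

variable [IsProbabilityMeasure μ]

/-- The events $w(t)=w_j$ are disjoint because the values are distinct, and their probabilities sum
to one. -/
theorem ae_mem_range (hw : IsNoise μ v p w) (t : ℕ) : ∀ᵐ ω ∂μ, ∃ j, w t ω = v j := by
  have h1 : μ.real (⋃ j, {ω | w t ω = v j}) = 1 := by
    rw [measureReal_iUnion_fintype _ fun j => hw.measurableSet_eq t j]
    · simp only [hw.law, hw.sum_eq_one]
    · intro i j hij
      refine Set.disjoint_left.2 fun ω h1 h2 => hij (hw.distinct ?_)
      exact h1.symm.trans h2
  have h2 : MeasurableSet (⋃ j, {ω | w t ω = v j}) :=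
    MeasurableSet.iUnion fun j => hw.measurableSet_eq t j
  have h3 : μ (⋃ j, {ω | w t ω = v j}) = 1 := by
    rw [measureReal_def] at h1
    rwa [ENNReal.toReal_eq_one_iff] at h1
  have h4 := (mem_ae_iff_prob_eq_one h2).2 h3
  filter_upwards [h4] with ω hω
  simpa using hω

theorem observedNoise_ae_eq (hw : IsNoise μ v p w) (t : ℕ) : observedNoise v w t =ᵐ[μ] w t := by
  filter_upwards [hw.ae_mem_range t] with ω ⟨j, hj⟩
  have : obs v w t ω = Pi.single j 1 := by
    ext i
    simp [obs, hj, Pi.single_apply, hw.distinct.eq_iff, eq_comm]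
  ext a
  rw [observedNoise, this, hj]
  simp [valueMatrix]

theorem memLp_observedNoise (hw : IsNoise μ v p w) (t : ℕ) : MemLp (observedNoise v w t) 2 μ :=
  memLp_of_bound_apply (hw.measurable_observedNoise t) _ (abs_observedNoise_le t)

theorem memLp (hw : IsNoise μ v p w) (t : ℕ) : MemLp (w t) 2 μ :=
  (memLp_congr_ae (hw.observedNoise_ae_eq t)).1 (hw.memLp_observedNoise t)

theorem integrable_obs (hw : IsNoise μ v p w) (t : ℕ) (j : Fin M) :
    Integrable (fun ω => obs v w t ω j) μ := by
  refine Integrable.of_bound (C := 1) ?_ (ae_of_all _ fun ω => ?_)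
  · exact ((measurable_pi_apply j).comp
      ((measurable_obs_law v).comp (hw.measurable t))).aestronglyMeasurable
  · have h := obs_mem_Icc (v := v) (w := w) t ω j
    rw [Real.norm_of_nonneg h.1]
    exact h.2

theorem integral_observedNoise (hw : IsNoise μ v p w) (t : ℕ) (a : Fin n) :
    ∫ ω, observedNoise v w t ω a ∂μ = noiseMean v p a := by
  simp only [observedNoise, noiseMean, mulVec, dotProduct]
  rw [integral_finsetSum _ fun j _ => (hw.integrable_obs t j).const_mul _]
  simp only [integral_const_mul, hw.integral_obs]

theorem integral_apply (hw : IsNoise μ v p w) (t : ℕ) (a : Fin n) :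
    ∫ ω, w t ω a ∂μ = noiseMean v p a := by
  rw [← hw.integral_observedNoise t a]
  refine integral_congr_ae ?_
  filter_upwards [hw.observedNoise_ae_eq t] with ω hω
  rw [hω]

/-- In each coordinate $z$ is independent of the centred noise, so the expectation factors. This
removes the cross term from the Bellman step. -/
theorem integral_dotProduct_sub_eq_zero (hw : IsNoise μ v p w) (t : ℕ) {z : Ω → Fin n → ℝ}
    (hz : Measurable[history w t] z) (hz2 : MemLp z 2 μ) :
    ∫ ω, z ω ⬝ᵥ (w t ω - noiseMean v p) ∂μ = 0 := by
  have hz2' := memLp_pi_iff.1 hz2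
  have hw2 : ∀ a, MemLp (fun ω => w t ω a - noiseMean v p a) 2 μ := fun a =>
    (memLp_pi_iff.1 (hw.memLp t) a).sub (memLp_const _)
  have hw' : MemLp (fun ω => w t ω - noiseMean v p) 2 μ := (hw.memLp t).sub (memLp_const _)
  rw [integral_dotProduct hz2 hw']
  refine Finset.sum_eq_zero fun a _ => ?_
  have hind : IndepFun (fun ω => z ω a) (fun ω => w t ω a - noiseMean v p a) μ := by
    rw [IndepFun_iff_Indep]
    refine indep_of_indep_of_le_left (indep_of_indep_of_le_right (hw.indep_history t) ?_) ?_
    · have : Measurable fun y : Fin n → ℝ => y a - noiseMean v p a := by fun_prop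
      exact (this.comp (comap_measurable (w t))).comap_le
    · exact ((measurable_pi_apply a).comp hz).comap_le
  have h0 : ∫ ω, (w t ω a - noiseMean v p a) ∂μ = 0 := by
    rw [integral_sub ((memLp_pi_iff.1 (hw.memLp t) a).integrable (by norm_num))
      (integrable_const _), hw.integral_apply]
    simp
  have := hind.integral_mul_eq_mul_integral (hz2' a).1 (hw2 a).1
  rw [h0, mul_zero] at this
  exact this

end IsNoise

theorem IsNoise.memLp_meanEstimate [IsProbabilityMeasure μ] (hw : IsNoise μ v p w) (t : ℕ) :
    MemLp (meanEstimate v w t) 2 μ := by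
  rcases eq_or_ne t 0 with rfl | ht
  · have : meanEstimate v w 0 = fun _ => 0 := funext meanEstimate_zero
    rw [this]
    exact memLp_const _
  · have : meanEstimate v w t
        = fun ω => (1 / (t : ℝ)) • ∑ i ∈ Finset.range t, observedNoise v w i ω :=
      funext (meanEstimate_of_pos ht)
    rw [this]
    exact (memLp_finsetSum (Finset.range t) fun i _ => hw.memLp_observedNoise i).const_smul
      (1 / (t : ℝ))

/-- The mean square error of the estimate decays like `1 / t`. -/
theorem IsNoise.integral_estimate_error_le [IsProbabilityMeasure μ] (hw : IsNoise μ v p w) (t : ℕ)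
    (ht : t ≠ 0) :
    ∫ ω, (meanEstimate v w t ω - noiseMean v p) ⬝ᵥ (meanEstimate v w t ω - noiseMean v p) ∂μ
      ≤ (∑ a, (∑ j, |v j a|) ^ 2) * (1 / (t : ℝ)) := by
  have ht' : (t : ℝ) ≠ 0 := by exact_mod_cast ht
  have hE : ∀ a, MemLp (fun ω => meanEstimate v w t ω a) 2 μ :=
    memLp_pi_iff.1 (hw.memLp_meanEstimate t)
  have hO : ∀ i a, MemLp (fun ω => observedNoise v w i ω a) 2 μ := fun i =>
    memLp_pi_iff.1 (hw.memLp_observedNoise i)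
  have hd : MemLp (fun ω => meanEstimate v w t ω - noiseMean v p) 2 μ :=
    (hw.memLp_meanEstimate t).sub (memLp_const _)
  rw [integral_dotProduct hd hd, Finset.sum_mul]
  refine Finset.sum_le_sum fun a _ => ?_
  have hform : (fun ω => meanEstimate v w t ω a)
      = (1 / (t : ℝ)) • ∑ i ∈ Finset.range t, fun ω => observedNoise v w i ω a := by
    ext ω
    rw [meanEstimate_of_pos ht]
    simp [Finset.sum_apply]
  have hmean : ∫ ω, meanEstimate v w t ω a ∂μ = noiseMean v p a := by
    simp_rw [meanEstimate_of_pos ht, Pi.smul_apply, Finset.sum_apply, smul_eq_mul]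
    rw [integral_const_mul, integral_finsetSum _ fun i _ => (hO i a).integrable (by norm_num)]
    simp only [hw.integral_observedNoise, Finset.sum_const, Finset.card_range, nsmul_eq_mul]
    field_simp
  have hvar : ∫ ω, (meanEstimate v w t ω a - noiseMean v p a)
        * (meanEstimate v w t ω a - noiseMean v p a) ∂μ
      = Var[fun ω => meanEstimate v w t ω a; μ] := by
    rw [variance_eq_integral (hE a).aemeasurable, hmean]
    simp only [sq]
  have hind : Set.Pairwise (↑(Finset.range t) : Set ℕ) fun i j =>
      IndepFun (fun ω => observedNoise v w i ω a) (fun ω => observedNoise v w j ω a) μ := by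
    intro i _ j _ hij
    have h := hw.indep.indepFun hij
    rw [IndepFun_iff_Indep] at h ⊢
    refine indep_of_indep_of_le_left (indep_of_indep_of_le_right h ?_) ?_
    · exact ((measurable_pi_apply a).comp (measurable_comap_observedNoise j)).comap_le
    · exact ((measurable_pi_apply a).comp (measurable_comap_observedNoise i)).comap_le
  have hone : ∀ i ∈ Finset.range t,
      Var[fun ω => observedNoise v w i ω a; μ] ≤ (∑ j, |v j a|) ^ 2 := by
    intro i _
    -- A variable with values in $[-b,b]$ has variance at most $b^2$.
    refine (variance_le_sq_of_bounded (a := -∑ j, |v j a|) (b := ∑ j, |v j a|)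
      (ae_of_all _ fun ω => abs_le.1 (abs_observedNoise_le i ω a)) (hO i a).aemeasurable).trans
      (le_of_eq ?_)
    ring
  simp only [Pi.sub_apply]
  rw [hvar, hform, variance_smul, IndepFun.variance_sum (fun i _ => hO i a) hind]
  have h1 := Finset.sum_le_sum hone
  rw [Finset.sum_const, Finset.card_range, nsmul_eq_mul] at h1
  calc _ ≤ (1 / (t : ℝ)) ^ 2 * (t * (∑ j, |v j a|) ^ 2) :=
        mul_le_mul_of_nonneg_left h1 (by positivity)
    _ = _ := by field_simp

end Noise

/-! The online policy is admissible. -/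

section Admissibility

variable {n m M : ℕ} {Ω : Type*} {A : Matrix (Fin n) (Fin n) ℝ} {B : Matrix (Fin n) (Fin m) ℝ}
  {Q : ℕ → Matrix (Fin n) (Fin n) ℝ} {R : ℕ → Matrix (Fin m) (Fin m) ℝ}
  {S : Matrix (Fin n) (Fin n) ℝ} {T : ℕ} {x₀ : Fin n → ℝ} {w : ℕ → Ω → Fin n → ℝ}
  {v : Fin M → Fin n → ℝ}

theorem measurable_mulVec_add_mulVec {k : ℕ} {_ : MeasurableSpace Ω} {x : Ω → Fin n → ℝ}
    {u : Ω → Fin m → ℝ} (F : Matrix (Fin k) (Fin n) ℝ) (G : Matrix (Fin k) (Fin m) ℝ)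
    (hx : Measurable x) (hu : Measurable u) : Measurable fun ω => F *ᵥ x ω + G *ᵥ u ω :=
  ((measurable_mulVec F).comp hx).add ((measurable_mulVec G).comp hu)

theorem measurable_feedback {_ : MeasurableSpace Ω} (t : ℕ) {x e : Ω → Fin n → ℝ}
    (hx : Measurable x) (he : Measurable e) :
    Measurable fun ω => feedback A B Q R S T t (x ω) (e ω) :=
  ((measurable_mulVec _).comp
    ((measurable_mulVec_add_mulVec _ _ hx he).add ((measurable_mulVec _).comp he))).neg

theorem state_onlinePolicy (t : ℕ) :
    state A B x₀ w (onlinePolicy A B Q R S T x₀ w v) t = onlineState A B Q R S T x₀ w v t := by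
  induction t with
  | zero => rfl
  | succ t ih =>
    funext ω
    simp only [state, ih]
    rfl

theorem measurable_state {u : ℕ → Ω → Fin m → ℝ} (hu : ∀ t, Measurable[history w t] (u t))
    (t : ℕ) : Measurable[history w t] (state A B x₀ w u t) := by
  induction t with
  | zero => exact measurable_const
  | succ t ih =>
    have hle : history w t ≤ history w (t + 1) := history_mono t.le_succ
    have h1 := ih.mono hle le_rfl
    have h2 := (hu t).mono hle le_rfl
    have h3 : Measurable[history w (t + 1)] (w t) := measurable_history_apply t.lt_succ_self
    let _ : MeasurableSpace Ω := history w (t + 1)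
    exact (measurable_mulVec_add_mulVec A B h1 h2).add h3

theorem measurable_onlineState (t : ℕ) :
    Measurable[history w t] (onlineState A B Q R S T x₀ w v t) := by
  induction t with
  | zero => exact measurable_const
  | succ t ih =>
    have hle : history w t ≤ history w (t + 1) := history_mono t.le_succ
    have h1 := ih.mono hle le_rfl
    have h2 := (measurable_meanEstimate (v := v) (w := w) t).mono hle le_rfl
    have h3 : Measurable[history w (t + 1)] (w t) := measurable_history_apply t.lt_succ_self
    let _ : MeasurableSpace Ω := history w (t + 1)
    exact (measurable_mulVec_add_mulVec A B h1 (measurable_feedback t h1 h2)).add h3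

theorem measurable_onlinePolicy (t : ℕ) :
    Measurable[history w t] (onlinePolicy A B Q R S T x₀ w v t) :=
  measurable_feedback t (measurable_onlineState t) (measurable_meanEstimate t)

variable [MeasurableSpace Ω] {μ : Measure Ω} {p : Fin M → ℝ}

theorem memLp_feedback (t : ℕ) {x e : Ω → Fin n → ℝ} (hx : MemLp x 2 μ) (he : MemLp e 2 μ) :
    MemLp (fun ω => feedback A B Q R S T t (x ω) (e ω)) 2 μ :=
  (memLp_mulVec _ (((memLp_mulVec _ hx).add (memLp_mulVec _ he)).add (memLp_mulVec _ he))).neg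

variable [IsProbabilityMeasure μ]

theorem memLp_state (hw : IsNoise μ v p w) {u : ℕ → Ω → Fin m → ℝ} (hu : ∀ t, MemLp (u t) 2 μ)
    (t : ℕ) : MemLp (state A B x₀ w u t) 2 μ := by
  induction t with
  | zero => exact memLp_const _
  | succ t ih => exact ((memLp_mulVec A ih).add (memLp_mulVec B (hu t))).add (hw.memLp t)

theorem memLp_onlineState (hw : IsNoise μ v p w) (t : ℕ) :
    MemLp (onlineState A B Q R S T x₀ w v t) 2 μ := by
  induction t with
  | zero => exact memLp_const _
  | succ t ih =>
    exact ((memLp_mulVec A ih).add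
      (memLp_mulVec B (memLp_feedback t ih (hw.memLp_meanEstimate t)))).add (hw.memLp t)

theorem admissible_onlinePolicy (hw : IsNoise μ v p w) :
    Admissible w μ (onlinePolicy A B Q R S T x₀ w v) := fun t =>
  ⟨measurable_onlinePolicy t, memLp_feedback t (memLp_onlineState hw t) (hw.memLp_meanEstimate t)⟩

end Admissibility

/-! The cost of an admissible control. -/

section Cost

variable {n m M : ℕ} (A : Matrix (Fin n) (Fin n) ℝ) (B : Matrix (Fin n) (Fin m) ℝ)
  (Q : Matrix (Fin n) (Fin n) ℝ) (R : Matrix (Fin m) (Fin m) ℝ)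

/-- One step of the Bellman equation along a noisy trajectory. -/
theorem bellman_step (hQ : Q.PosSemidef) (hR : R.PosDef) (k : ℕ) (x e d : Fin n → ℝ)
    (u f : Fin m → ℝ)
    (hf : f = -((R + Bᵀ * ric A B Q R k * B)⁻¹ *ᵥ
      ((Bᵀ * ric A B Q R k * A) *ᵥ x + (Bᵀ * ric A B Q R k) *ᵥ e
        + (Bᵀ * adj A B Q R k) *ᵥ e))) :
    x ⬝ᵥ (Q *ᵥ x) + u ⬝ᵥ (R *ᵥ u)
      + ((A *ᵥ x + B *ᵥ u + d) ⬝ᵥ (ric A B Q R k *ᵥ (A *ᵥ x + B *ᵥ u + d))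
        + 2 * ((A *ᵥ x + B *ᵥ u + d) ⬝ᵥ (adj A B Q R k *ᵥ e)))
      = (x ⬝ᵥ (ric A B Q R (k + 1) *ᵥ x) + 2 * (x ⬝ᵥ (adj A B Q R (k + 1) *ᵥ e)))
        + (u - f) ⬝ᵥ ((R + Bᵀ * ric A B Q R k * B) *ᵥ (u - f))
        + 2 * ((ric A B Q R k *ᵥ (A *ᵥ x + B *ᵥ u)) ⬝ᵥ (d - e))
        + (d ⬝ᵥ (ric A B Q R k *ᵥ d) + 2 * (d ⬝ᵥ (adj A B Q R k *ᵥ e)))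
        - ((ric A B Q R k + adj A B Q R k) *ᵥ e) ⬝ᵥ
          ((B * (R + Bᵀ * ric A B Q R k * B)⁻¹ * Bᵀ) *ᵥ
            ((ric A B Q R k + adj A B Q R k) *ᵥ e)) := by
  have hP := posSemidef_ric (A := A) (B := B) hQ hR k
  have hPs := (posSemidef_iff_real.1 hP).1
  -- The choice $g=(P+L)e$ produces $y'Pe$, while the noisy step contains $y'Pd$; the discrepancy is
  -- the term $(Py)\cdot(d-e)$, centred when $e$ is the mean of $d$.
  have h := complete_square (A := A) (B := B) (Q := Q) hR hP x
    ((ric A B Q R k + adj A B Q R k) *ᵥ e) u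
  have hu : u - f = u + (R + Bᵀ * ric A B Q R k * B)⁻¹ *ᵥ
      (Bᵀ *ᵥ (ric A B Q R k *ᵥ (A *ᵥ x)) + Bᵀ *ᵥ ((ric A B Q R k + adj A B Q R k) *ᵥ e)) := by
    rw [hf, sub_neg_eq_add]
    simp only [← mulVec_mulVec, add_mulVec, mulVec_add, add_assoc]
  have hadj : x ⬝ᵥ (adj A B Q R (k + 1) *ᵥ e)
      = x ⬝ᵥ ((Aᵀ - Aᵀ * ric A B Q R k * B * (R + Bᵀ * ric A B Q R k * B)⁻¹ * Bᵀ) *ᵥ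
        ((ric A B Q R k + adj A B Q R k) *ᵥ e)) := by
    rw [mulVec_mulVec, adj]
  rw [hu, hadj, ric, riccatiStep]
  set y := A *ᵥ x + B *ᵥ u
  have e1 : y ⬝ᵥ ((ric A B Q R k + adj A B Q R k) *ᵥ e)
      = y ⬝ᵥ (ric A B Q R k *ᵥ e) + y ⬝ᵥ (adj A B Q R k *ᵥ e) := by
    rw [add_mulVec, dotProduct_add]
  have e2 : (y + d) ⬝ᵥ (ric A B Q R k *ᵥ (y + d))
      = y ⬝ᵥ (ric A B Q R k *ᵥ y) + 2 * (y ⬝ᵥ (ric A B Q R k *ᵥ d))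
        + d ⬝ᵥ (ric A B Q R k *ᵥ d) := by
    simp only [mulVec_add, dotProduct_add, add_dotProduct]
    rw [dotProduct_mulVec_symm hPs d y]
    ring
  have e3 : (ric A B Q R k *ᵥ y) ⬝ᵥ (d - e)
      = y ⬝ᵥ (ric A B Q R k *ᵥ d) - y ⬝ᵥ (ric A B Q R k *ᵥ e) := by
    rw [← dotProduct_transpose_mulVec, hPs, mulVec_sub, dotProduct_sub]
  rw [e1] at h
  rw [e2, e3, add_dotProduct y d]
  linarith

variable (T : ℕ) {Ω : Type*} [MeasurableSpace Ω] (μ : Measure Ω) (w : ℕ → Ω → Fin n → ℝ)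

/-- The part of the Bellman step that depends on neither the state nor the control. -/
noncomputable def noiseCost (e : Fin n → ℝ) (t k : ℕ) : ℝ :=
  ∫ ω, (w t ω ⬝ᵥ (ric A B Q R k *ᵥ w t ω) + 2 * (w t ω ⬝ᵥ (adj A B Q R k *ᵥ e))) ∂μ
    - ((ric A B Q R k + adj A B Q R k) *ᵥ e) ⬝ᵥ
          ((B * (R + Bᵀ * ric A B Q R k * B)⁻¹ * Bᵀ) *ᵥ
            ((ric A B Q R k + adj A B Q R k) *ᵥ e))

/-- The cost of the optimal feedback when the mean `e` of the noise is known. -/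
noncomputable def knownMeanCost (x₀ e : Fin n → ℝ) : ℝ :=
  x₀ ⬝ᵥ (ric A B Q R (T + 1) *ᵥ x₀) + 2 * (x₀ ⬝ᵥ (adj A B Q R (T + 1) *ᵥ e))
    + ∑ t ∈ Finset.range (T + 1), noiseCost A B Q R μ w e t (T + 1 - (t + 1))

variable {A B Q R T μ w} [IsProbabilityMeasure μ] {v : Fin M → Fin n → ℝ} {p : Fin M → ℝ}

theorem integral_sub_add_add_add_sub_const {a b c d e : Ω → ℝ} (ha : Integrable a μ)
    (hb : Integrable b μ) (hc : Integrable c μ) (hd : Integrable d μ) (he : Integrable e μ)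
    (h : ℝ) : ∫ ω, (a ω - b ω + c ω + d ω + e ω - h) ∂μ
      = ∫ ω, a ω ∂μ - ∫ ω, b ω ∂μ + ∫ ω, c ω ∂μ + ∫ ω, d ω ∂μ + ∫ ω, e ω ∂μ - h := by
  have h1 : Integrable (fun ω => a ω - b ω) μ := ha.sub hb
  have h2 : Integrable (fun ω => a ω - b ω + c ω) μ := h1.add hc
  have h3 : Integrable (fun ω => a ω - b ω + c ω + d ω) μ := h2.add hd
  have h4 : Integrable (fun ω => a ω - b ω + c ω + d ω + e ω) μ := h3.add he
  rw [integral_sub h4 (integrable_const _), integral_add h3 he, integral_add h2 hd,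
    integral_add h1 hc, integral_sub ha hb, integral_const, probReal_univ, one_smul]

/-- The expectation of `bellman_step` with $d=w(t)$ and $e=\mu_w$. Since $P(Ax+Bu)$ depends only on
the past, its product with $w(t)-\mu_w$ integrates to zero. -/
theorem integral_bellman_step (hQ : Q.PosSemidef) (hR : R.PosDef) (hw : IsNoise μ v p w)
    (x₀ : Fin n → ℝ) {u : ℕ → Ω → Fin m → ℝ} (hu : Admissible w μ u) (t k : ℕ)
    (f : Ω → Fin m → ℝ) (hfm : MemLp f 2 μ)
    (hf : ∀ ω, f ω = -((R + Bᵀ * ric A B Q R k * B)⁻¹ *ᵥ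
      ((Bᵀ * ric A B Q R k * A) *ᵥ state A B x₀ w u t ω
        + (Bᵀ * ric A B Q R k) *ᵥ noiseMean v p + (Bᵀ * adj A B Q R k) *ᵥ noiseMean v p))) :
    ∫ ω, (state A B x₀ w u t ω ⬝ᵥ (Q *ᵥ state A B x₀ w u t ω) + u t ω ⬝ᵥ (R *ᵥ u t ω)) ∂μ
      = ∫ ω, (state A B x₀ w u t ω ⬝ᵥ (ric A B Q R (k + 1) *ᵥ state A B x₀ w u t ω)
            + 2 * (state A B x₀ w u t ω ⬝ᵥ (adj A B Q R (k + 1) *ᵥ noiseMean v p))) ∂μ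
        - ∫ ω, (state A B x₀ w u (t + 1) ω ⬝ᵥ (ric A B Q R k *ᵥ state A B x₀ w u (t + 1) ω)
            + 2 * (state A B x₀ w u (t + 1) ω ⬝ᵥ (adj A B Q R k *ᵥ noiseMean v p))) ∂μ
        + (∫ ω, (u t ω - f ω) ⬝ᵥ ((R + Bᵀ * ric A B Q R k * B) *ᵥ (u t ω - f ω)) ∂μ
          + noiseCost A B Q R μ w (noiseMean v p) t k) := by
  have hx := memLp_state (A := A) (B := B) (x₀ := x₀) hw fun t => (hu t).2
  have hxm := measurable_state (A := A) (B := B) (x₀ := x₀) fun t => (hu t).1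
  set e := noiseMean v p
  set x := state A B x₀ w u
  have hy : MemLp (fun ω => ric A B Q R k *ᵥ (A *ᵥ x t ω + B *ᵥ u t ω)) 2 μ :=
    memLp_mulVec _ ((memLp_mulVec A (hx t)).add (memLp_mulVec B (hu t).2))
  have hym : Measurable[history w t] fun ω => ric A B Q R k *ᵥ (A *ᵥ x t ω + B *ᵥ u t ω) :=
    (measurable_mulVec _).comp (measurable_mulVec_add_mulVec A B (hxm t) (hu t).1)
  have horth := hw.integral_dotProduct_sub_eq_zero t hym hy
  have hd : MemLp (fun ω => w t ω - e) 2 μ := (hw.memLp t).sub (memLp_const _)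
  have hg : MemLp (fun ω => u t ω - f ω) 2 μ := (hu t).2.sub hfm
  have i2 : ∀ s j, Integrable (fun ω => x s ω ⬝ᵥ (ric A B Q R j *ᵥ x s ω)
      + 2 * (x s ω ⬝ᵥ (adj A B Q R j *ᵥ e))) μ := fun s j =>
    (integrable_dotProduct (hx s) (memLp_mulVec _ (hx s))).add
      ((integrable_dotProduct (hx s) (memLp_const _)).const_mul 2)
  have i3 : Integrable (fun ω => w t ω ⬝ᵥ (ric A B Q R k *ᵥ w t ω)
      + 2 * (w t ω ⬝ᵥ (adj A B Q R k *ᵥ e))) μ :=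
    (integrable_dotProduct (hw.memLp t) (memLp_mulVec _ (hw.memLp t))).add
      ((integrable_dotProduct (hw.memLp t) (memLp_const _)).const_mul 2)
  have i4 := integrable_dotProduct hg (memLp_mulVec (R + Bᵀ * ric A B Q R k * B) hg)
  have i5 := (integrable_dotProduct hy hd).const_mul 2
  set h := ((ric A B Q R k + adj A B Q R k) *ᵥ e) ⬝ᵥ
          ((B * (R + Bᵀ * ric A B Q R k * B)⁻¹ * Bᵀ) *ᵥ
            ((ric A B Q R k + adj A B Q R k) *ᵥ e))
  have hpt : ∀ ω, x t ω ⬝ᵥ (Q *ᵥ x t ω) + u t ω ⬝ᵥ (R *ᵥ u t ω)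
      = (x t ω ⬝ᵥ (ric A B Q R (k + 1) *ᵥ x t ω)
            + 2 * (x t ω ⬝ᵥ (adj A B Q R (k + 1) *ᵥ e)))
        - (x (t + 1) ω ⬝ᵥ (ric A B Q R k *ᵥ x (t + 1) ω)
            + 2 * (x (t + 1) ω ⬝ᵥ (adj A B Q R k *ᵥ e)))
        + (u t ω - f ω) ⬝ᵥ ((R + Bᵀ * ric A B Q R k * B) *ᵥ (u t ω - f ω))
        + 2 * ((ric A B Q R k *ᵥ (A *ᵥ x t ω + B *ᵥ u t ω)) ⬝ᵥ (w t ω - e))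
        + (w t ω ⬝ᵥ (ric A B Q R k *ᵥ w t ω) + 2 * (w t ω ⬝ᵥ (adj A B Q R k *ᵥ e)))
        - h := by
    intro ω
    have := bellman_step A B Q R hQ hR k (x t ω) e (w t ω) (u t ω) (f ω) (hf ω)
    have hs : x (t + 1) ω = A *ᵥ x t ω + B *ᵥ u t ω + w t ω := rfl
    rw [hs]
    linarith
  simp_rw [hpt]
  rw [integral_sub_add_add_add_sub_const (i2 t (k + 1)) (i2 (t + 1) k) i4 i5 i3,
    integral_const_mul, horth, noiseCost]
  ring

theorem feedback_eq (t : ℕ) (x e : Fin n → ℝ) :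
    feedback A B (fun _ => Q) (fun _ => R) 0 T t x e
      = -((R + Bᵀ * ric A B Q R (T + 1 - (t + 1)) * B)⁻¹ *ᵥ
      ((Bᵀ * ric A B Q R (T + 1 - (t + 1)) * A) *ᵥ x
        + (Bᵀ * ric A B Q R (T + 1 - (t + 1))) *ᵥ e
        + (Bᵀ * adj A B Q R (T + 1 - (t + 1))) *ᵥ e)) := by
  rw [feedback, upsilon, riccatiP, adjointL, riccatiBack_eq, adjointBack_eq]

theorem upsilon_eq (t : ℕ) : upsilon A B (fun _ => Q) (fun _ => R) 0 T t
    = R + Bᵀ * ric A B Q R (T + 1 - (t + 1)) * B := by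
  rw [upsilon, riccatiP, riccatiBack_eq]

/-- The cost of an admissible control is the cost for known mean plus its distance from the
optimal feedback. -/
theorem cost_eq_knownMeanCost_add (hQ : Q.PosSemidef) (hR : R.PosDef) (hw : IsNoise μ v p w)
    (x₀ : Fin n → ℝ) {u : ℕ → Ω → Fin m → ℝ} (hu : Admissible w μ u) :
    cost A B (fun _ => Q) (fun _ => R) 0 T x₀ w μ u
      = knownMeanCost A B Q R T μ w x₀ (noiseMean v p)
        + ∑ t ∈ Finset.range (T + 1),
          ∫ ω, (u t ω - feedback A B (fun _ => Q) (fun _ => R) 0 T t (state A B x₀ w u t ω)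
              (noiseMean v p)) ⬝ᵥ (upsilon A B (fun _ => Q) (fun _ => R) 0 T t *ᵥ
            (u t ω - feedback A B (fun _ => Q) (fun _ => R) 0 T t (state A B x₀ w u t ω)
              (noiseMean v p))) ∂μ := by
  have hx := memLp_state (A := A) (B := B) (x₀ := x₀) hw fun t => (hu t).2
  -- The expected state-dependent part of the value function at time $t$. It telescopes, and
  -- vanishes at $T+1$ because the terminal $P$ and $L$ are zero.
  let Φ : ℕ → ℝ := fun t => ∫ ω, (state A B x₀ w u t ω ⬝ᵥ
      (ric A B Q R (T + 1 - t) *ᵥ state A B x₀ w u t ω)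
    + 2 * (state A B x₀ w u t ω ⬝ᵥ (adj A B Q R (T + 1 - t) *ᵥ noiseMean v p))) ∂μ
  have hstep : ∀ t ∈ Finset.range (T + 1),
      ∫ ω, (state A B x₀ w u t ω ⬝ᵥ (Q *ᵥ state A B x₀ w u t ω) + u t ω ⬝ᵥ (R *ᵥ u t ω)) ∂μ
        = (Φ t - Φ (t + 1))
          + (∫ ω, (u t ω - feedback A B (fun _ => Q) (fun _ => R) 0 T t (state A B x₀ w u t ω)
              (noiseMean v p)) ⬝ᵥ (upsilon A B (fun _ => Q) (fun _ => R) 0 T t *ᵥ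
            (u t ω - feedback A B (fun _ => Q) (fun _ => R) 0 T t (state A B x₀ w u t ω)
              (noiseMean v p))) ∂μ
            + noiseCost A B Q R μ w (noiseMean v p) t (T + 1 - (t + 1))) := by
    intro t ht
    have hk : T + 1 - t = T + 1 - (t + 1) + 1 := by
      have := Finset.mem_range.1 ht
      omega
    simp only [Φ]
    rw [hk, upsilon_eq]
    exact integral_bellman_step hQ hR hw x₀ hu t _ _
      (memLp_feedback t (hx t) (memLp_const _)) fun ω => feedback_eq t _ _
  have h0 : Φ 0 = x₀ ⬝ᵥ (ric A B Q R (T + 1) *ᵥ x₀)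
      + 2 * (x₀ ⬝ᵥ (adj A B Q R (T + 1) *ᵥ noiseMean v p)) := by
    simp [Φ, state]
  have hT : Φ (T + 1) = 0 := by
    simp [Φ, ric, adj]
  rw [cost, Finset.sum_congr rfl hstep, Finset.sum_add_distrib, Finset.sum_add_distrib,
    Finset.sum_range_sub', h0, hT, knownMeanCost]
  simp only [zero_mulVec, dotProduct_zero, integral_zero]
  ring

theorem knownMeanCost_le_cost (hQ : Q.PosSemidef) (hR : R.PosDef) (hw : IsNoise μ v p w)
    (x₀ : Fin n → ℝ) {u : ℕ → Ω → Fin m → ℝ} (hu : Admissible w μ u) :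
    knownMeanCost A B Q R T μ w x₀ (noiseMean v p)
      ≤ cost A B (fun _ => Q) (fun _ => R) 0 T x₀ w μ u := by
  rw [cost_eq_knownMeanCost_add hQ hR hw x₀ hu]
  refine le_add_of_nonneg_right (Finset.sum_nonneg fun t _ => integral_nonneg fun ω => ?_)
  rw [upsilon_eq]
  exact (posSemidef_iff_real.1
    (posDef_add_conj hR (posSemidef_ric hQ hR (T + 1 - (t + 1)))).posSemidef).2 _

theorem knownMeanCost_le_optimalCost (hQ : Q.PosSemidef) (hR : R.PosDef) (hw : IsNoise μ v p w)
    (x₀ : Fin n → ℝ) :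
    knownMeanCost A B Q R T μ w x₀ (noiseMean v p)
      ≤ optimalCost A B (fun _ => Q) (fun _ => R) 0 T x₀ w μ := by
  -- The zero control shows that the infimum is over a nonempty set. Attainment is not needed.
  refine le_csInf ⟨_, fun _ _ => 0, fun t => ⟨measurable_const, memLp_const _⟩, rfl⟩ ?_
  rintro _ ⟨u, hu, rfl⟩
  exact knownMeanCost_le_cost hQ hR hw x₀ hu

/-- The online policy competes in the infimum, and `knownMeanCost` bounds the competing costs below.
The $O(\ln T)$ claim needs this because it concerns the absolute value. -/
theorem regret_nonneg (hQ : Q.PosSemidef) (hR : R.PosDef) (hw : IsNoise μ v p w)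
    (x₀ : Fin n → ℝ) : 0 ≤ regret A B (fun _ => Q) (fun _ => R) 0 T x₀ w μ v := by
  refine sub_nonneg.2 (csInf_le ⟨knownMeanCost A B Q R T μ w x₀ (noiseMean v p), ?_⟩
    ⟨_, admissible_onlinePolicy hw, rfl⟩)
  rintro _ ⟨u, hu, rfl⟩
  exact knownMeanCost_le_cost hQ hR hw x₀ hu

/-- At a common state the controls differ by $-\Upsilon^{-1}B'(P+L)(e-d)$, and one factor
$\Upsilon^{-1}$ cancels against $\Upsilon$. -/
theorem feedback_sub_quadratic (hQ : Q.PosSemidef) (hR : R.PosDef) (t : ℕ) (x e d : Fin n → ℝ) :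
    (feedback A B (fun _ => Q) (fun _ => R) 0 T t x e
        - feedback A B (fun _ => Q) (fun _ => R) 0 T t x d) ⬝ᵥ
      (upsilon A B (fun _ => Q) (fun _ => R) 0 T t *ᵥ
        (feedback A B (fun _ => Q) (fun _ => R) 0 T t x e
          - feedback A B (fun _ => Q) (fun _ => R) 0 T t x d))
      = (e - d) ⬝ᵥ (matD A B (fun _ => Q) (fun _ => R) 0 T t *ᵥ (e - d)) := by
  have hΥ : (upsilon A B (fun _ => Q) (fun _ => R) 0 T t).PosDef := by
    rw [upsilon_eq]
    exact posDef_add_conj hR (posSemidef_ric hQ hR _)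
  have hu := (isUnit_iff_isUnit_det _).1 hΥ.isUnit
  simp only [feedback, matD]
  set Υ := upsilon A B (fun _ => Q) (fun _ => R) 0 T t
  set P := riccatiP A B (fun _ => Q) (fun _ => R) 0 T (t + 1)
  set L := adjointL A B (fun _ => Q) (fun _ => R) 0 T (t + 1)
  set z := (Bᵀ * (P + L)) *ᵥ (e - d) with hz
  have h1 : -(Υ⁻¹ *ᵥ ((Bᵀ * P * A) *ᵥ x + (Bᵀ * P) *ᵥ e + (Bᵀ * L) *ᵥ e))
      - -(Υ⁻¹ *ᵥ ((Bᵀ * P * A) *ᵥ x + (Bᵀ * P) *ᵥ d + (Bᵀ * L) *ᵥ d)) = -(Υ⁻¹ *ᵥ z) := by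
    have : z = ((Bᵀ * P * A) *ᵥ x + (Bᵀ * P) *ᵥ e + (Bᵀ * L) *ᵥ e)
        - ((Bᵀ * P * A) *ᵥ x + (Bᵀ * P) *ᵥ d + (Bᵀ * L) *ᵥ d) := by
      rw [hz, Matrix.mul_add, add_mulVec, mulVec_sub (Bᵀ * P), mulVec_sub (Bᵀ * L)]
      abel
    rw [this, mulVec_sub]
    abel
  have h2 : ((P + L)ᵀ * B * Υ⁻¹ * Bᵀ * (P + L)) *ᵥ (e - d)
      = (Bᵀ * (P + L))ᵀ *ᵥ (Υ⁻¹ *ᵥ z) := by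
    rw [hz]
    simp only [mulVec_mulVec, transpose_mul, transpose_transpose, Matrix.mul_assoc]
  have h3 : Υ *ᵥ (Υ⁻¹ *ᵥ z) = z := by rw [mulVec_mulVec, mul_nonsing_inv _ hu, one_mulVec]
  rw [h1, h2, dotProduct_transpose_mulVec, ← hz, mulVec_neg, neg_dotProduct_neg, h3,
    dotProduct_comm]

/-- Both feedbacks are evaluated at the state of the online policy itself, so no comparison of two
trajectories is needed. -/
theorem regret_le_sum (hQ : Q.PosSemidef) (hR : R.PosDef) (hw : IsNoise μ v p w)
    (x₀ : Fin n → ℝ) :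
    regret A B (fun _ => Q) (fun _ => R) 0 T x₀ w μ v
      ≤ ∑ t ∈ Finset.range (T + 1), ∫ ω, (meanEstimate v w t ω - noiseMean v p) ⬝ᵥ
          (matD A B (fun _ => Q) (fun _ => R) 0 T t *ᵥ
            (meanEstimate v w t ω - noiseMean v p)) ∂μ := by
  have h1 := knownMeanCost_le_optimalCost (A := A) (B := B) (T := T) hQ hR hw x₀
  have h2 := cost_eq_knownMeanCost_add (A := A) (B := B) (T := T) hQ hR hw x₀
    (admissible_onlinePolicy (A := A) (B := B) (Q := fun _ => Q) (R := fun _ => R) (S := 0)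
      (T := T) (x₀ := x₀) hw)
  simp only [state_onlinePolicy] at h2
  simp only [onlinePolicy, feedback_sub_quadratic hQ hR] at h2
  rw [regret]
  change cost A B (fun _ => Q) (fun _ => R) 0 T x₀ w μ
    (onlinePolicy A B (fun _ => Q) (fun _ => R) 0 T x₀ w v) = _ at h2
  linarith

theorem sum_range_add_one_eq_sum_Icc (f : ℕ → ℝ) (T : ℕ) :
    ∑ t ∈ Finset.range T, f (t + 1) = ∑ t ∈ Finset.Icc 1 T, f t := by
  induction T with
  | zero => simp
  | succ T ih => rw [Finset.sum_range_succ, ih, Finset.sum_Icc_succ_top (by omega)]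

theorem trace_mul_vecMulVec (D : Matrix (Fin n) (Fin n) ℝ) (x : Fin n → ℝ) :
    (D * vecMulVec x x).trace = x ⬝ᵥ (D *ᵥ x) := by
  rw [mul_vecMulVec, trace_vecMulVec, dotProduct_comm]

theorem regret_le_trace_add (hQ : Q.PosSemidef) (hR : R.PosDef) (hw : IsNoise μ v p w) {C : ℝ}
    (hC : 0 ≤ C)
    (hD : ∀ T t x, x ⬝ᵥ (matD A B (fun _ => Q) (fun _ => R) 0 T t *ᵥ x) ≤ C * (x ⬝ᵥ x))
    (x₀ : Fin n → ℝ) (T : ℕ) :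
    regret A B (fun _ => Q) (fun _ => R) 0 T x₀ w μ v
      ≤ (matD A B (fun _ => Q) (fun _ => R) 0 T 0
          * vecMulVec (noiseMean v p) (noiseMean v p)).trace
        + C * (∑ a, (∑ j, |v j a|) ^ 2) * ∑ t ∈ Finset.Icc 1 T, 1 / (t : ℝ) := by
  refine (regret_le_sum hQ hR hw x₀).trans ?_
  -- The term $t=0$ is split off: there the error is the deterministic vector $-\mu_w$.
  rw [Finset.sum_range_succ', add_comm, ← sum_range_add_one_eq_sum_Icc, Finset.mul_sum]
  refine add_le_add (le_of_eq ?_) (Finset.sum_le_sum fun t _ => ?_)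
  · simp only [meanEstimate_zero, zero_sub, mulVec_neg, neg_dotProduct_neg, integral_const,
      probReal_univ, one_smul, trace_mul_vecMulVec]
  · have he : MemLp (fun ω => meanEstimate v w (t + 1) ω - noiseMean v p) 2 μ :=
      (hw.memLp_meanEstimate (t + 1)).sub (memLp_const _)
    have h1 := integral_mono (integrable_dotProduct he (memLp_mulVec
      (matD A B (fun _ => Q) (fun _ => R) 0 T (t + 1)) he))
      ((integrable_dotProduct he he).const_mul C) fun ω => hD T (t + 1) _
    rw [integral_const_mul] at h1
    refine h1.trans ?_
    rw [mul_assoc]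
    exact mul_le_mul_of_nonneg_left (hw.integral_estimate_error_le (t + 1) t.succ_ne_zero) hC

end Cost

/-! ### Logarithmic growth and the conclusion. -/

theorem sum_Icc_one_div_le (T : ℕ) :
    ∑ t ∈ Finset.Icc 1 T, 1 / (t : ℝ) ≤ 1 + Real.log T := by
  have h := harmonic_le_one_add_log T
  rw [harmonic_eq_sum_Icc] at h
  simpa using h

end OnlineLQ

theorem theorem3 {n m M : ℕ}
    (A : Matrix (Fin n) (Fin n) ℝ) (B : Matrix (Fin n) (Fin m) ℝ)
    (Q : Matrix (Fin n) (Fin n) ℝ) (R : Matrix (Fin m) (Fin m) ℝ)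
    (hQ : Q.PosSemidef) (hR : R.PosDef)
    (hstab : OnlineLQ.Stabilizable A B) (hobs : OnlineLQ.Observable A (CFC.sqrt Q))
    {Ω : Type*} [MeasurableSpace Ω] (μ : Measure Ω) [IsProbabilityMeasure μ]
    (v : Fin M → Fin n → ℝ) (p : Fin M → ℝ) (w : ℕ → Ω → Fin n → ℝ)
    (hw : OnlineLQ.IsNoise μ v p w) :
    (∃ c : ℝ, 0 < c ∧ ∀ (x₀ : Fin n → ℝ) (T : ℕ),
      OnlineLQ.regret A B (fun _ => Q) (fun _ => R) 0 T x₀ w μ v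
        ≤ (OnlineLQ.matD A B (fun _ => Q) (fun _ => R) 0 T 0
              * Matrix.vecMulVec (OnlineLQ.noiseMean v p) (OnlineLQ.noiseMean v p)).trace
          + c * ∑ t ∈ Finset.Icc 1 T, 1 / (t : ℝ)) ∧
    ∀ x₀ : Fin n → ℝ,
      (fun T : ℕ => OnlineLQ.regret A B (fun _ => Q) (fun _ => R) 0 T x₀ w μ v)
        =O[atTop] (fun T : ℕ => Real.log (T : ℝ)) := by
  obtain ⟨C, hC, hD⟩ := OnlineLQ.exists_matD_le hQ hR hstab hobs
  have key := OnlineLQ.regret_le_trace_add hQ hR hw hC hD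
  set K := C * (∑ a, (∑ j, |v j a|) ^ 2)
  have hK : 0 ≤ K := by positivity
  -- $K$ may vanish, so $1$ is added to obtain a positive constant.
  refine ⟨⟨K + 1, by positivity, fun x₀ T => (key x₀ T).trans ?_⟩, fun x₀ => ?_⟩
  · gcongr
    linarith
  · set b := OnlineLQ.noiseMean v p ⬝ᵥ OnlineLQ.noiseMean v p
    have hb : 0 ≤ b := OnlineLQ.dotProduct_self_nonneg' _
    -- The trace is at most $Cb$. Once $\ln T\ge1$, both $Cb\le Cb\ln T$ and $K(1+\ln T)\le2K\ln T$
    -- hold.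
    refine Asymptotics.IsBigO.of_bound (C * b + 2 * K) ?_
    have hlog : ∀ᶠ T : ℕ in atTop, 1 ≤ Real.log (T : ℝ) :=
      (Real.tendsto_log_atTop.comp tendsto_natCast_atTop_atTop).eventually_ge_atTop 1
    filter_upwards [hlog] with T hT
    rw [Real.norm_of_nonneg (OnlineLQ.regret_nonneg hQ hR hw x₀), Real.norm_of_nonneg (by linarith)]
    have h1 := key x₀ T
    rw [OnlineLQ.trace_mul_vecMulVec] at h1
    have h2 := hD T 0 (OnlineLQ.noiseMean v p)
    have h3 := mul_le_mul_of_nonneg_left (OnlineLQ.sum_Icc_one_div_le T) hK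
    have h4 : K * (1 + Real.log T) ≤ 2 * K * Real.log T := by nlinarith
    have h5 : C * b ≤ C * b * Real.log T := le_mul_of_one_le_right (by positivity) hT
    linarith
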